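/- **First Existence and Uniqueness Theorem.** Let $S$ be a closed connected oriented polyhedral surface of genus $g\ge 1$ with a geodesic triangulation $T$ all of whose faces are flat triangles; that is, $S$ is obtained by gluing finitely many nondegenerate Euclidean triangles isometrically and compatibly with orientation along their sides, in pairs (two faces may share several vertices and edges, and vertices or sides of one triangle may be identified). For an oriented edge $e$ denote by $h_e,t_e,l_e,r_e$ its head, tail, left face and right face, and put $c(e)=\frac12\cot\alpha_e+\frac12\cot\beta_e$, where $\alpha_e,\beta_e$ are the angles opposite to $e$ in the two triangles adjacent to $e$. Let $p\colon\widetilde T\to T$ be the universal covering, with the lifted triangulation and metric, and let $\widetilde T^0$ and $\widetilde T^2$ be its sets of vertices and faces. Fix a base vertex and a standard basis $\alpha_1,\dots,\alpha_g,\beta_1,\dots,\beta_g$ of the fundamental group of $S$, i.e. generators such that $\alpha_1\beta_1\alpha_1^{-1}\beta_1^{-1}\cdots\alpha_g\beta_g\alpha_g^{-1}\beta_g^{-1}$ is null-homotopic; let $d_{\alpha_k},d_{\beta_k}$ be the corresponding deck transformations of $\widetilde T$. A *discrete Abelian integral of the first kind* with A-periods $A_1,\dots,A_g\in\mathbb C$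 is a pair of functions $f=(\mathrm{Re} f\colon\widetilde T^0\to\mathbb R,\ \mathrm{Im} f\colon\widetilde T^2\to\mathbb R)$ such that $$[\mathrm{Im} f](l_e)-[\mathrm{Im} f](r_e)=c(e)\bigl([\mathrm{Re} f](h_e)-[\mathrm{Re} f](t_e)\bigr)$$ for each oriented edge $e$ of $\widetilde T$, and such that for some $B_1,\dots,B_g\in\mathbb C$ and all $k=1,\dots,g$, $z\in\widetilde T^0$, $w\in\widetilde T^2$, $$[\mathrm{Re} f](d_{\alpha_k}z)-[\mathrm{Re} f](z)=\mathrm{Re} A_k,\qquad [\mathrm{Re} f](d_{\beta_k}z)-[\mathrm{Re} f](z)=\mathrm{Re} B_k,$$ $$[\mathrm{Im} f](d_{\alpha_k}w)-[\mathrm{Im} f](w)=\mathrm{Im} A_k,\qquad [\mathrm{Im} f](d_{\beta_k}w)-[\mathrm{Im} f](w)=\mathrm{Im} B_k.$$ Then for any $A_1,\dots,A_g\in\mathbb C$ there exists a discrete Abelian integral of the first kind with A-periods $A_1,\dots,A_g$. It is unique up to constant: for any two such integrals $f,f'$ there are $a,b\in\mathbb R$ with $\mathrm{Re} f'=\mathrm{Re}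 f+a$ on $\widetilde T^0$ and $\mathrm{Im} f'=\mathrm{Im} f+b$ on $\widetilde T^2$. -/

import Mathlib

/-- A triangulated oriented polyhedral surface (without boundary): Euclidean triangles glued
isometrically along their sides in orientation-compatible pairs. `D` is the set of oriented edges;
`inv` reverses the orientation of an edge; `next e` is the oriented edge that follows `e` on the
boundary of the face to the left of `e` (traversed counterclockwise); `len e` is the length of `e`.
Sides of one and the same triangle may be glued to each other and vertices of a face may coincide. The surface is
closed (compact) exactly when `D` is finite. -/
structure PolyhedralSurface (D : Type*) where
  inv : D → D
  next : D → D
  inv_inv : ∀ e, inv (inv e) = e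
  inv_ne : ∀ e, inv e ≠ e
  next_next_next : ∀ e, next (next (next e)) = e
  next_ne : ∀ e, next e ≠ e
  /-- every vertex has finite degree: turning around the tail of `e` brings one back to `e` -/
  locally_finite : ∀ e, e ∈ Function.periodicPts (fun x => next (inv x))
  len : D → ℝ
  len_pos : ∀ e, 0 < len e
  len_inv : ∀ e, len (inv e) = len e
  len_triangle : ∀ e, len e < len (next e) + len (next (next e))

namespace PolyhedralSurface

variable {D : Type*}

/-- The rotation about the tail of an oriented edge. -/
def vertexPerm (X : PolyhedralSurface D) : Equiv.Perm D where
  toFun e := X.next (X.inv e)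
  invFun e := X.inv (X.next (X.next e))
  left_inv e := by simp [X.next_next_next, X.inv_inv]
  right_inv e := by simp [X.next_next_next, X.inv_inv]

/-- The rotation around the face to the left of an oriented edge. -/
def facePerm (X : PolyhedralSurface D) : Equiv.Perm D where
  toFun := X.next
  invFun e := X.next (X.next e)
  left_inv e := X.next_next_next e
  right_inv e := X.next_next_next e

/-- Vertices: classes of oriented edges with the same tail. -/
def Vertex (X : PolyhedralSurface D) : Type _ :=
  Quotient (Equiv.Perm.SameCycle.setoid X.vertexPerm)

/-- Faces: classes of oriented edges with the same left shore. -/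
def Face (X : PolyhedralSurface D) : Type _ :=
  Quotient (Equiv.Perm.SameCycle.setoid X.facePerm)

/-- The tail `t_e`. -/
def tail (X : PolyhedralSurface D) (e : D) : X.Vertex :=
  Quotient.mk (Equiv.Perm.SameCycle.setoid X.vertexPerm) e

/-- The head `h_e`. -/
def head (X : PolyhedralSurface D) (e : D) : X.Vertex := X.tail (X.inv e)

/-- The left shore `l_e`. -/
def left (X : PolyhedralSurface D) (e : D) : X.Face :=
  Quotient.mk (Equiv.Perm.SameCycle.setoid X.facePerm) e

/-- The right shore `r_e`. -/
def right (X : PolyhedralSurface D) (e : D) : X.Face := X.left (X.inv e)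

/-- Connectedness of the surface. -/
def IsConnected (X : PolyhedralSurface D) : Prop :=
  ∀ e e' : D, Relation.EqvGen (fun x y => y = X.inv x ∨ y = X.next x) e e'

/-! ### Discrete analytic functions -/

/-- The angle opposite to `e` in the triangle to the left of `e` (by the law of cosines). -/
noncomputable def oppAngle (X : PolyhedralSurface D) (e : D) : ℝ :=
  Real.arccos ((X.len (X.next e) ^ 2 + X.len (X.next (X.next e)) ^ 2 - X.len e ^ 2) /
    (2 * X.len (X.next e) * X.len (X.next (X.next e))))

/-- The cotan edge weight. -/
noncomputable def weight (X : PolyhedralSurface D) (e : D) : ℝ :=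
  1 / 2 * Real.cot (X.oppAngle e) + 1 / 2 * Real.cot (X.oppAngle (X.inv e))

/-- A pair of real functions: the real part on the vertices, the imaginary part on the faces. -/
structure DiscreteFunction (X : PolyhedralSurface D) where
  re : X.Vertex → ℝ
  im : X.Face → ℝ

/-- Discrete analytic functions: pairs of conjugate functions. -/
def DiscreteFunction.IsAnalytic {X : PolyhedralSurface D} (f : X.DiscreteFunction) : Prop :=
  ∀ e : D, f.im (X.left e) - f.im (X.right e) =
    X.weight e * (f.re (X.head e) - f.re (X.tail e))

/-! ### Genus: half of the first Betti number -/

/-- Closed simplicial 1-cochains. -/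
def closedCochains (X : PolyhedralSurface D) : Submodule ℝ (D → ℝ) where
  carrier := {ω | (∀ e, ω (X.inv e) = -ω e) ∧
    ∀ e, ω e + ω (X.next e) + ω (X.next (X.next e)) = 0}
  add_mem' {a b} ha hb := by
    refine ⟨fun e => ?_, fun e => ?_⟩
    · simp only [Pi.add_apply, ha.1, hb.1]; ring
    · have h1 := ha.2 e
      have h2 := hb.2 e
      simp only [Pi.add_apply]; linarith
  zero_mem' := by simp
  smul_mem' c a ha := by
    refine ⟨fun e => ?_, fun e => ?_⟩
    · simp only [Pi.smul_apply, smul_eq_mul, ha.1]; ring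
    · have h1 := ha.2 e
      simp only [Pi.smul_apply, smul_eq_mul]
      rw [← mul_add, ← mul_add, h1, mul_zero]

/-- The coboundary of a function on the vertices. -/
def coboundary (X : PolyhedralSurface D) : (X.Vertex → ℝ) →ₗ[ℝ] (D → ℝ) where
  toFun u e := u (X.head e) - u (X.tail e)
  map_add' u v := by ext e; simp only [Pi.add_apply]; ring
  map_smul' c u := by ext e; simp only [Pi.smul_apply, smul_eq_mul, RingHom.id_apply]; ring

/-- A closed connected surface has genus `g` when its first cohomology with real coefficients has
dimension `2g`. -/
def HasGenus (X : PolyhedralSurface D) (g : ℕ) : Prop :=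
  Module.finrank ℝ (X.closedCochains ⧸ (LinearMap.range X.coboundary).submoduleOf
    X.closedCochains) = 2 * g

/-! ### Edge paths and their homotopy -/

/-- `X.IsPath v l w`: the list `l` of oriented edges is a path from `v` to `w`. -/
def IsPath (X : PolyhedralSurface D) : X.Vertex → List D → X.Vertex → Prop
  | v, [], w => v = w
  | v, e :: l, w => X.tail e = v ∧ X.IsPath (X.head e) l w

/-- Elementary homotopies of paths starting at `v`: removal of an edge followed by its inverse, and
removal of the boundary of a face. -/
inductive ElemHomotopy (X : PolyhedralSurface D) (v : X.Vertex) : List D → List D → Prop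
  | spur (l : List D) (e : D) (m : List D) (w : X.Vertex) (hl : X.IsPath v l (X.tail e))
      (hm : X.IsPath (X.tail e) m w) : ElemHomotopy X v (l ++ ([e, X.inv e] ++ m)) (l ++ m)
  | face (l : List D) (e : D) (m : List D) (w : X.Vertex) (hl : X.IsPath v l (X.tail e))
      (hm : X.IsPath (X.tail e) m w) :
      ElemHomotopy X v (l ++ ([e, X.next e, X.next (X.next e)] ++ m)) (l ++ m)

/-- Homotopy, with fixed ends, of edge paths starting at `v`. -/
def Homotopic (X : PolyhedralSurface D) (v : X.Vertex) : List D → List D → Prop :=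
  Relation.EqvGen (X.ElemHomotopy v)

/-- The path traversed backwards. -/
def revPath (X : PolyhedralSurface D) (l : List D) : List D := (l.map X.inv).reverse

variable {X : PolyhedralSurface D}

theorem tail_next (e : D) : X.tail (X.next e) = X.head e := by
  refine Quotient.sound ?_
  change Equiv.Perm.SameCycle X.vertexPerm (X.next e) (X.inv e)
  refine Equiv.Perm.SameCycle.symm ⟨1, ?_⟩
  simp [vertexPerm, X.inv_inv]

theorem head_inv (e : D) : X.head (X.inv e) = X.tail e := by
  simp [head, X.inv_inv]

theorem head_next_next (e : D) : X.head (X.next (X.next e)) = X.tail e := by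
  rw [← tail_next, X.next_next_next]

theorem isPath_append {v w : X.Vertex} {l m : List D} :
    X.IsPath v (l ++ m) w ↔ ∃ u, X.IsPath v l u ∧ X.IsPath u m w := by
  induction l generalizing v with
  | nil => simp [IsPath]
  | cons e l ih =>
    simp only [List.cons_append, IsPath, ih]
    constructor
    · rintro ⟨h, u, h1, h2⟩; exact ⟨u, ⟨h, h1⟩, h2⟩
    · rintro ⟨u, ⟨h, h1⟩, h2⟩; exact ⟨h, u, h1, h2⟩

theorem IsPath.append {u v w : X.Vertex} {l m : List D} (hl : X.IsPath v l u)
    (hm : X.IsPath u m w) : X.IsPath v (l ++ m) w := isPath_append.2 ⟨u, hl, hm⟩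

theorem IsPath.unique {v w w' : X.Vertex} {l : List D} (h : X.IsPath v l w)
    (h' : X.IsPath v l w') : w = w' := by
  induction l generalizing v with
  | nil => exact (Eq.symm h).trans h'
  | cons e l ih => exact ih h.2 h'.2

theorem isPath_spur (e : D) : X.IsPath (X.tail e) [e, X.inv e] (X.tail e) :=
  ⟨rfl, rfl, head_inv e⟩

theorem isPath_face (e : D) :
    X.IsPath (X.tail e) [e, X.next e, X.next (X.next e)] (X.tail e) :=
  ⟨rfl, tail_next e, tail_next (X.next e), head_next_next e⟩

theorem IsPath.rev {v w : X.Vertex} {l : List D} (h : X.IsPath v l w) :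
    X.IsPath w (X.revPath l) v := by
  induction l generalizing v with
  | nil => exact Eq.symm h
  | cons e l ih =>
    obtain ⟨h1, h2⟩ := h
    have : X.revPath (e :: l) = X.revPath l ++ [X.inv e] := by simp [revPath]
    rw [this]
    exact (ih h2).append ⟨rfl, (head_inv e).trans h1⟩

theorem ElemHomotopy.isPath_iff {v w : X.Vertex} {l m : List D} (h : X.ElemHomotopy v l m) :
    X.IsPath v l w ↔ X.IsPath v m w := by
  have key : ∀ (a k m : List D) (u : X.Vertex), X.IsPath v a u → X.IsPath u k u →
      (X.IsPath v (a ++ (k ++ m)) w ↔ X.IsPath v (a ++ m) w) := by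
    intro a k m u ha hk
    constructor
    · intro h
      obtain ⟨x, h1, h2⟩ := isPath_append.1 h
      obtain ⟨y, h3, h4⟩ := isPath_append.1 h2
      obtain rfl := ha.unique h1
      obtain rfl := hk.unique h3
      exact ha.append h4
    · intro h
      obtain ⟨x, h1, h2⟩ := isPath_append.1 h
      obtain rfl := ha.unique h1
      exact ha.append (hk.append h2)
  cases h with
  | spur a e m w' ha hm => exact key _ _ _ _ ha (isPath_spur e)
  | face a e m w' ha hm => exact key _ _ _ _ ha (isPath_face e)

theorem Homotopic.isPath_iff {v w : X.Vertex} {l m : List D} (h : X.Homotopic v l m) :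
    X.IsPath v l w ↔ X.IsPath v m w := by
  induction h with
  | rel _ _ h => exact h.isPath_iff
  | refl _ => exact Iff.rfl
  | symm _ _ _ ih => exact ih.symm
  | trans _ _ _ _ _ ih1 ih2 => exact ih1.trans ih2

theorem Homotopic.refl {v : X.Vertex} (l : List D) : X.Homotopic v l l :=
  Relation.EqvGen.refl l

theorem Homotopic.symm {v : X.Vertex} {l m : List D} (h : X.Homotopic v l m) :
    X.Homotopic v m l := Relation.EqvGen.symm _ _ h

theorem Homotopic.trans {v : X.Vertex} {l m k : List D} (h : X.Homotopic v l m)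
    (h' : X.Homotopic v m k) : X.Homotopic v l k := Relation.EqvGen.trans _ _ _ h h'

theorem ElemHomotopy.homotopic {v : X.Vertex} {l m : List D} (h : X.ElemHomotopy v l m) :
    X.Homotopic v l m := Relation.EqvGen.rel _ _ h

theorem Homotopic.append_left {u v : X.Vertex} {k l m : List D} (hk : X.IsPath v k u)
    (h : X.Homotopic u l m) : X.Homotopic v (k ++ l) (k ++ m) := by
  induction h with
  | rel _ _ h =>
    refine Relation.EqvGen.rel _ _ ?_
    cases h with
    | spur a e m w ha hm =>
      rw [← List.append_assoc, ← List.append_assoc k]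
      exact ElemHomotopy.spur _ e m w (hk.append ha) hm
    | face a e m w ha hm =>
      rw [← List.append_assoc, ← List.append_assoc k]
      exact ElemHomotopy.face _ e m w (hk.append ha) hm
  | refl _ => exact Homotopic.refl _
  | symm _ _ _ ih => exact ih.symm
  | trans _ _ _ _ _ ih1 ih2 => exact ih1.trans ih2

theorem Homotopic.append_right {u v w : X.Vertex} {k l m : List D} (h : X.Homotopic v l m)
    (hl : X.IsPath v l u) (hk : X.IsPath u k w) : X.Homotopic v (l ++ k) (m ++ k) := by
  induction h with
  | rel _ _ h =>
    refine Relation.EqvGen.rel _ _ ?_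
    cases h with
    | spur a e m x ha hm =>
      obtain ⟨y, h1, h2⟩ := isPath_append.1 hl
      obtain ⟨z, h3, h4⟩ := isPath_append.1 h2
      obtain rfl := ha.unique h1
      obtain rfl := (isPath_spur e).unique h3
      rw [List.append_assoc, List.append_assoc, List.append_assoc]
      exact ElemHomotopy.spur a e (m ++ k) w ha (h4.append hk)
    | face a e m x ha hm =>
      obtain ⟨y, h1, h2⟩ := isPath_append.1 hl
      obtain ⟨z, h3, h4⟩ := isPath_append.1 h2
      obtain rfl := ha.unique h1
      obtain rfl := (isPath_face e).unique h3
      rw [List.append_assoc, List.append_assoc, List.append_assoc]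
      exact ElemHomotopy.face a e (m ++ k) w ha (h4.append hk)
  | refl _ => exact Homotopic.refl _
  | symm _ _ h ih => exact (ih ((Homotopic.isPath_iff h).2 hl)).symm
  | trans _ _ _ h1 _ ih1 ih2 => exact (ih1 hl).trans (ih2 ((Homotopic.isPath_iff h1).1 hl))

theorem Homotopic.append {u v w : X.Vertex} {k k' l l' : List D} (h : X.Homotopic v l l')
    (hl : X.IsPath v l u) (h' : X.Homotopic u k k') (hk : X.IsPath u k w) :
    X.Homotopic v (l ++ k) (l' ++ k') :=
  (h.append_right hl hk).trans (Homotopic.append_left (h.isPath_iff.1 hl) h')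

theorem homotopic_rev_append {v w : X.Vertex} {l : List D} (h : X.IsPath v l w) :
    X.Homotopic w (X.revPath l ++ l) [] := by
  induction l generalizing v with
  | nil => exact Homotopic.refl _
  | cons e l ih =>
    obtain ⟨h1, h2⟩ := h
    have e1 : X.revPath (e :: l) ++ e :: l =
        X.revPath l ++ ([X.inv e, X.inv (X.inv e)] ++ l) := by simp [revPath, X.inv_inv]
    rw [e1]
    refine Homotopic.trans (ElemHomotopy.homotopic ?_) (ih h2)
    exact ElemHomotopy.spur _ (X.inv e) l w h2.rev h2

theorem revPath_revPath (l : List D) : X.revPath (X.revPath l) = l := by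
  have : X.inv ∘ X.inv = id := funext X.inv_inv
  simp [revPath, List.map_reverse, this]

theorem homotopic_append_rev {v w : X.Vertex} {l : List D} (h : X.IsPath v l w) :
    X.Homotopic v (l ++ X.revPath l) [] := by
  have := homotopic_rev_append h.rev
  rwa [revPath_revPath] at this

theorem Homotopic.rev {v w : X.Vertex} {l m : List D} (h : X.Homotopic v l m)
    (hl : X.IsPath v l w) : X.Homotopic w (X.revPath l) (X.revPath m) := by
  have hm := h.isPath_iff.1 hl
  have h1 : X.Homotopic w (X.revPath l ++ []) (X.revPath l ++ (m ++ X.revPath m)) :=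
    Homotopic.append_left hl.rev (homotopic_append_rev hm).symm
  have h2 : X.Homotopic w ((X.revPath l ++ l) ++ X.revPath m)
      ((X.revPath l ++ m) ++ X.revPath m) :=
    (Homotopic.append_left hl.rev h).append_right (hl.rev.append hl) hm.rev
  have h3 : X.Homotopic w ((X.revPath l ++ l) ++ X.revPath m) ([] ++ X.revPath m) :=
    (homotopic_rev_append hl).append_right (hl.rev.append hl) hm.rev
  rw [List.append_nil, ← List.append_assoc] at h1
  exact h1.trans (h2.symm.trans h3)

/-! ### The fundamental group -/

/-- Homotopy of closed paths with base point `v`. -/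
def loopSetoid (X : PolyhedralSurface D) (v : X.Vertex) : Setoid {l : List D // X.IsPath v l v} where
  r l m := X.Homotopic v l.1 m.1
  iseqv := ⟨fun _ => Homotopic.refl _, fun h => h.symm, fun h h' => h.trans h'⟩

/-- The fundamental group with base point `v`: homotopy classes of closed paths. -/
def Pi1 (X : PolyhedralSurface D) (v : X.Vertex) : Type _ := Quotient (X.loopSetoid v)

instance (v : X.Vertex) : Group (X.Pi1 v) where
  mul := Quotient.map₂ (fun l m => ⟨l.1 ++ m.1, l.2.append m.2⟩)
    fun l _ h m _ h' => Homotopic.append h l.2 h' m.2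
  one := Quotient.mk _ ⟨[], rfl⟩
  inv := Quotient.map (fun l => ⟨X.revPath l.1, l.2.rev⟩) fun l _ h => Homotopic.rev h l.2
  mul_assoc := by
    rintro ⟨a⟩ ⟨b⟩ ⟨c⟩
    exact congrArg (Quotient.mk _) (Subtype.ext (List.append_assoc _ _ _))
  one_mul := by
    rintro ⟨a⟩
    rfl
  mul_one := by
    rintro ⟨a⟩
    exact congrArg (Quotient.mk _) (Subtype.ext (List.append_nil _))
  inv_mul_cancel := by
    rintro ⟨a⟩
    exact Quotient.sound (homotopic_rev_append a.2)

/-- A standard basis of the fundamental group: generators `α₁, …, α_g, β₁, …, β_g` such that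
`α₁ β₁ α₁⁻¹ β₁⁻¹ ⋯ α_g β_g α_g⁻¹ β_g⁻¹` is null-homotopic. -/
def IsStandardBasis {v : X.Vertex} {g : ℕ} (α β : Fin g → X.Pi1 v) : Prop :=
  Subgroup.closure (Set.range α ∪ Set.range β) = ⊤ ∧
    (List.ofFn fun k => α k * β k * (α k)⁻¹ * (β k)⁻¹).prod = 1

/-! ### The universal covering -/

/-- A path from `v` to the tail of an oriented edge, together with this edge. -/
abbrev CoverPre (X : PolyhedralSurface D) (v : X.Vertex) : Type _ :=
  {p : List D × D // X.IsPath v p.1 (X.tail p.2)}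

def coverSetoid (X : PolyhedralSurface D) (v : X.Vertex) : Setoid (X.CoverPre v) where
  r p q := X.Homotopic v p.1.1 q.1.1 ∧ p.1.2 = q.1.2
  iseqv := ⟨fun _ => ⟨Homotopic.refl _, rfl⟩, fun h => ⟨h.1.symm, h.2.symm⟩,
    fun h h' => ⟨h.1.trans h'.1, h.2.trans h'.2⟩⟩

/-- Oriented edges of the universal covering: an oriented edge `e` of the surface together with the
homotopy class of a path from the base point to the tail of `e`. -/
def CoverDart (X : PolyhedralSurface D) (v : X.Vertex) : Type _ := Quotient (X.coverSetoid v)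

/-- The covering projection. -/
def proj (X : PolyhedralSurface D) (v : X.Vertex) : X.CoverDart v → D :=
  Quotient.lift (fun p => p.1.2) fun _ _ h => h.2

def coverInv (X : PolyhedralSurface D) (v : X.Vertex) : X.CoverDart v → X.CoverDart v :=
  Quotient.map (fun p => ⟨(p.1.1 ++ [p.1.2], X.inv p.1.2), p.2.append ⟨rfl, rfl⟩⟩) (by
    rintro ⟨⟨l, e⟩, hl⟩ ⟨⟨m, e'⟩, hm⟩ ⟨h, rfl⟩
    exact ⟨h.append_right hl (w := X.head e) ⟨rfl, rfl⟩, rfl⟩)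

def coverNext (X : PolyhedralSurface D) (v : X.Vertex) : X.CoverDart v → X.CoverDart v :=
  Quotient.map (fun p => ⟨(p.1.1 ++ [p.1.2], X.next p.1.2),
      p.2.append ⟨rfl, (tail_next p.1.2).symm⟩⟩) (by
    rintro ⟨⟨l, e⟩, hl⟩ ⟨⟨m, e'⟩, hm⟩ ⟨h, rfl⟩
    exact ⟨h.append_right hl (w := X.head e) ⟨rfl, rfl⟩, rfl⟩)

theorem proj_coverInv (v : X.Vertex) (e : X.CoverDart v) :
    X.proj v (X.coverInv v e) = X.inv (X.proj v e) := by
  obtain ⟨p⟩ := e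
  rfl

theorem proj_coverNext (v : X.Vertex) (e : X.CoverDart v) :
    X.proj v (X.coverNext v e) = X.next (X.proj v e) := by
  obtain ⟨p⟩ := e
  rfl

theorem tail_vertexPerm (e : D) : X.tail (X.next (X.inv e)) = X.tail e := by
  rw [tail_next, head_inv]

/-- Turning about a vertex of the covering does not change the class of the path. -/
theorem coverNext_coverInv (v : X.Vertex) (l : List D) (e : D) (h : X.IsPath v l (X.tail e)) :
    X.coverNext v (X.coverInv v (Quotient.mk (X.coverSetoid v) ⟨(l, e), h⟩)) =
      Quotient.mk (X.coverSetoid v)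
        ⟨(l, X.next (X.inv e)), by rw [tail_vertexPerm]; exact h⟩ := by
  refine Quotient.sound ⟨?_, rfl⟩
  have := (ElemHomotopy.spur l e [] _ h rfl).homotopic
  simpa using this

theorem iterate_coverNext_coverInv (v : X.Vertex) (n : ℕ) (l : List D) (e : D)
    (h : X.IsPath v l (X.tail e)) :
    ∃ h', (fun x => X.coverNext v (X.coverInv v x))^[n]
      (Quotient.mk (X.coverSetoid v) ⟨(l, e), h⟩) =
      Quotient.mk (X.coverSetoid v) ⟨(l, (fun x => X.next (X.inv x))^[n] e), h'⟩ := by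
  induction n generalizing e with
  | zero => exact ⟨h, rfl⟩
  | succ n ih =>
    obtain ⟨h', hh⟩ := ih (X.next (X.inv e)) (by rw [tail_vertexPerm]; exact h)
    exact ⟨h', (congrArg (fun x => X.coverNext v (X.coverInv v x))^[n]
      (coverNext_coverInv v l e h)).trans hh⟩

/-- The universal covering of a surface with base vertex `v`, with the lifted triangulation
and metric. -/
def universalCover (X : PolyhedralSurface D) (v : X.Vertex) :
    PolyhedralSurface (X.CoverDart v) where
  inv := X.coverInv v
  next := X.coverNext v
  inv_inv := by
    rintro ⟨⟨⟨l, e⟩, h⟩⟩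
    refine Quotient.sound ⟨?_, X.inv_inv e⟩
    have := (ElemHomotopy.spur l e [] _ h rfl).homotopic
    simpa using this
  inv_ne e h := by
    have := congrArg (X.proj v) h
    rw [proj_coverInv] at this
    exact X.inv_ne _ this
  next_next_next := by
    rintro ⟨⟨⟨l, e⟩, h⟩⟩
    refine Quotient.sound ⟨?_, X.next_next_next e⟩
    have := (ElemHomotopy.face l e [] _ h rfl).homotopic
    simpa using this
  next_ne e h := by
    have := congrArg (X.proj v) h
    rw [proj_coverNext] at this
    exact X.next_ne _ this
  locally_finite := by
    rintro ⟨⟨⟨l, e⟩, h⟩⟩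
    obtain ⟨n, hn, hp⟩ := X.locally_finite e
    refine ⟨n, hn, ?_⟩
    obtain ⟨h', hh⟩ := iterate_coverNext_coverInv v n l e h
    exact hh.trans (congrArg (Quotient.mk _) (Subtype.ext (Prod.ext rfl hp)))
  len e := X.len (X.proj v e)
  len_pos e := X.len_pos _
  len_inv e := by rw [proj_coverInv, X.len_inv]
  len_triangle e := by
    rw [proj_coverNext, proj_coverNext, proj_coverNext]
    exact X.len_triangle _

/-- The deck transformation `d_γ` of the universal covering, on oriented edges. It commutes with the
projection (`proj_deck`) and takes the base point (the class of the constant path) to the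
end of the lift of `γ`, that is, the class of `γ` (`deck_base`). -/
def deck {v : X.Vertex} (γ : X.Pi1 v) : X.CoverDart v → X.CoverDart v :=
  Quotient.map₂ (fun (l : {l : List D // X.IsPath v l v}) (p : X.CoverPre v) =>
      (⟨(l.1 ++ p.1.1, p.1.2), l.2.append p.2⟩ : X.CoverPre v)) (by
    rintro l l' h ⟨⟨m, e⟩, hm⟩ ⟨⟨m', e'⟩, hm'⟩ ⟨h', rfl⟩
    exact ⟨Homotopic.append h l.2 h' hm, rfl⟩) γ

theorem proj_deck {v : X.Vertex} (γ : X.Pi1 v) (e : X.CoverDart v) :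
    X.proj v (deck γ e) = X.proj v e := by
  obtain ⟨l⟩ := γ
  obtain ⟨p⟩ := e
  rfl

theorem deck_base {v : X.Vertex} (l : {l : List D // X.IsPath v l v}) (e : D)
    (he : X.tail e = v) :
    deck (Quotient.mk (X.loopSetoid v) l)
      (Quotient.mk (X.coverSetoid v) ⟨([], e), Eq.symm he⟩) =
      Quotient.mk (X.coverSetoid v) ⟨(l.1, e), by rw [he]; exact l.2⟩ :=
  congrArg (Quotient.mk _) (Subtype.ext (Prod.ext (List.append_nil _) rfl))

theorem deck_inv {v : X.Vertex} (γ : X.Pi1 v) (e : X.CoverDart v) :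
    deck γ ((X.universalCover v).inv e) = (X.universalCover v).inv (deck γ e) := by
  obtain ⟨l⟩ := γ
  obtain ⟨p⟩ := e
  exact congrArg (Quotient.mk _)
    (Subtype.ext (Prod.ext (List.append_assoc _ _ _).symm rfl))

theorem deck_next {v : X.Vertex} (γ : X.Pi1 v) (e : X.CoverDart v) :
    deck γ ((X.universalCover v).next e) = (X.universalCover v).next (deck γ e) := by
  obtain ⟨l⟩ := γ
  obtain ⟨p⟩ := e
  exact congrArg (Quotient.mk _)
    (Subtype.ext (Prod.ext (List.append_assoc _ _ _).symm rfl))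

theorem sameCycle_of_semiconj {E : Type*} {σ τ : Equiv.Perm E} {f : E → E}
    (h : ∀ x, f (σ x) = τ (f x)) {x y : E} (hxy : σ.SameCycle x y) :
    τ.SameCycle (f x) (f y) := by
  have hn : ∀ (n : ℕ) (z : E), f ((σ ^ n) z) = (τ ^ n) (f z) := by
    intro n
    induction n with
    | zero => intro z; rfl
    | succ n ih => intro z; rw [pow_succ, pow_succ, Equiv.Perm.mul_apply, Equiv.Perm.mul_apply, ih, h]
  obtain ⟨i, rfl⟩ := hxy
  obtain ⟨n, rfl | rfl⟩ := i.eq_nat_or_neg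
  · exact ⟨n, by rw [zpow_natCast, zpow_natCast, hn]⟩
  · refine Equiv.Perm.SameCycle.symm ⟨n, ?_⟩
    rw [zpow_natCast, ← hn, ← zpow_natCast, ← Equiv.Perm.mul_apply, ← zpow_add]
    simp

/-- The deck transformation `d_γ` on the vertices of the universal covering. -/
def deckVertex {v : X.Vertex} (γ : X.Pi1 v) :
    (X.universalCover v).Vertex → (X.universalCover v).Vertex :=
  Quotient.map (deck γ) fun _ _ h => sameCycle_of_semiconj
    (σ := (X.universalCover v).vertexPerm) (τ := (X.universalCover v).vertexPerm)
    (fun x => by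
      change deck γ ((X.universalCover v).next ((X.universalCover v).inv x)) = _
      rw [deck_next, deck_inv]; rfl) h

/-- The deck transformation `d_γ` on the faces of the universal covering. -/
def deckFace {v : X.Vertex} (γ : X.Pi1 v) :
    (X.universalCover v).Face → (X.universalCover v).Face :=
  Quotient.map (deck γ) fun _ _ h => sameCycle_of_semiconj
    (σ := (X.universalCover v).facePerm) (τ := (X.universalCover v).facePerm)
    (fun x => deck_next γ x) h

/-! ### Multi-valued functions and discrete Abelian integrals -/

/-- `f` is a multi-valued function with A-periods `A` and B-periods `B`. -/
def HasPeriods {v : X.Vertex} {g : ℕ} (α β : Fin g → X.Pi1 v)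
    (f : (X.universalCover v).DiscreteFunction) (A B : Fin g → ℂ) : Prop :=
  ∀ k : Fin g,
    (∀ z, f.re (deckVertex (α k) z) - f.re z = (A k).re) ∧
    (∀ z, f.re (deckVertex (β k) z) - f.re z = (B k).re) ∧
    (∀ w, f.im (deckFace (α k) w) - f.im w = (A k).im) ∧
    (∀ w, f.im (deckFace (β k) w) - f.im w = (B k).im)

/-- `f` is a discrete Abelian integral of the first kind, that is, a multi-valued discrete analytic
function, with A-periods `A` (and some B-periods). -/
def IsAbelianIntegral {v : X.Vertex} {g : ℕ} (α β : Fin g → X.Pi1 v)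
    (f : (X.universalCover v).DiscreteFunction) (A : Fin g → ℂ) : Prop :=
  (∃ B : Fin g → ℂ, HasPeriods α β f A B) ∧ f.IsAnalytic

end PolyhedralSurface

/-! The problem is linear and descends to the closed surface. The differential of Re f is a closed
cochain ω, that of Im f is the dual cochain η = `hodge` ω, and η is coclosed because Im f is
single-valued around vertices of the covering. So one seeks a harmonic ω with prescribed A-periods
of ω and of η. To integrate η along edge paths, write it as the difference of a corner function c
under rotation about a vertex; the differences of c inside the faces form the closed cochain θ =
`primalMap` η, which has the same periods.

Uniqueness rests on the Riemann bilinear identity `IsStandardBasis.exists_degree`. Develop a path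
into the plane by (ω, θ); for a closed polygon `crossSum` is twice the signed area. The product of
commutators is a zero chain and is null-homotopic, so the homotopy sweeps all faces with one
multiplicity d. Computing the area in two ways relates the periods to d times the total wedge
product, which by `sum_wedge_primalMap` is three times the energy ∑ ω η. The energy is positive
definite triangle by triangle (`cot_quadratic_pos`), although single weights may be negative.
Moreover d ≠ 0, since the genus forces the period map to be onto. Hence vanishing A-periods give ω =
0.

Existence is then a dimension count: being coclosed imposes dim(exact) equations and the A-periods
2g more, in a space of closed cochains of dimension dim(exact) + 2g. Injectivity gives surjectivity.
-/

namespace PolyhedralSurface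

variable {D : Type*} {X : PolyhedralSurface D}

/-! ### Sums of cochains along edge paths -/

/-- The sum of a cochain along a list of oriented edges. -/
def pathSum (ω : D → ℝ) (l : List D) : ℝ := (l.map ω).sum

@[simp] theorem pathSum_nil (ω : D → ℝ) : pathSum ω [] = 0 := rfl

@[simp] theorem pathSum_cons (ω : D → ℝ) (e : D) (l : List D) :
    pathSum ω (e :: l) = ω e + pathSum ω l := by simp [pathSum]

@[simp] theorem pathSum_append (ω : D → ℝ) (l m : List D) :
    pathSum ω (l ++ m) = pathSum ω l + pathSum ω m := by simp [pathSum]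

theorem pathSum_flatten_eq_zero {ω : D → ℝ} {L : List (List D)}
    (h : ∀ l ∈ L, pathSum ω l = 0) : pathSum ω L.flatten = 0 := by
  induction L with
  | nil => rfl
  | cons l L ih =>
    rw [List.flatten_cons, pathSum_append, h l (by simp), ih fun m hm => h m (by simp [hm]),
      add_zero]

theorem pathSum_revPath {ω : D → ℝ} (hω : ∀ e, ω (X.inv e) = -ω e) (l : List D) :
    pathSum ω (X.revPath l) = -pathSum ω l := by
  induction l with
  | nil => simp [revPath]
  | cons e l ih =>
    have : X.revPath (e :: l) = X.revPath l ++ [X.inv e] := by simp [revPath]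
    rw [this, pathSum_append, ih]
    simp only [pathSum_cons, pathSum_nil, hω]
    ring

theorem pathSum_eq_of_homotopic {ω : D → ℝ} (hω : ω ∈ X.closedCochains) {v : X.Vertex}
    {l m : List D} (h : X.Homotopic v l m) : pathSum ω l = pathSum ω m := by
  induction h with
  | rel _ _ h =>
    cases h with
    | spur a e m w ha hm =>
      have := hω.1 e
      simp only [pathSum_append, pathSum_cons, pathSum_nil]; linarith
    | face a e m w ha hm =>
      have := hω.2 e
      simp only [pathSum_append, pathSum_cons, pathSum_nil]; linarith
  | refl _ => rfl
  | symm _ _ _ ih => exact ih.symm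
  | trans _ _ _ _ _ ih1 ih2 => exact ih1.trans ih2

/-- The antisymmetrized iterated sum of two cochains along a list of oriented edges. -/
def crossSum (ω θ : D → ℝ) : List D → ℝ
  | [] => 0
  | e :: l => ω e * pathSum θ l - θ e * pathSum ω l + crossSum ω θ l

/-- The shuffle rule for iterated sums: pairs with one edge in each block contribute the determinant
of the total displacements. -/
theorem crossSum_append (ω θ : D → ℝ) (l m : List D) :
    crossSum ω θ (l ++ m) = crossSum ω θ l + crossSum ω θ m +
      (pathSum ω l * pathSum θ m - pathSum θ l * pathSum ω m) := by
  induction l with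
  | nil => simp [crossSum]
  | cons e l ih =>
    simp only [List.cons_append, crossSum, pathSum_append, pathSum_cons, ih]
    ring

theorem crossSum_revPath {ω θ : D → ℝ} (hω : ∀ e, ω (X.inv e) = -ω e)
    (hθ : ∀ e, θ (X.inv e) = -θ e) (l : List D) :
    crossSum ω θ (X.revPath l) = -crossSum ω θ l := by
  induction l with
  | nil => simp [revPath, crossSum]
  | cons e l ih =>
    have : X.revPath (e :: l) = X.revPath l ++ [X.inv e] := by simp [revPath]
    rw [this, crossSum_append, ih, pathSum_revPath hω, pathSum_revPath hθ]
    simp only [crossSum, pathSum_cons, pathSum_nil, hω, hθ]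
    ring

/-- The list of oriented edges of a commutator. -/
def commPath (X : PolyhedralSurface D) (a b : List D) : List D :=
  a ++ b ++ X.revPath a ++ X.revPath b

theorem pathSum_commPath {ω : D → ℝ} (hω : ∀ e, ω (X.inv e) = -ω e) (a b : List D) :
    pathSum ω (X.commPath a b) = 0 := by
  simp only [commPath, pathSum_append, pathSum_revPath hω]
  ring

theorem crossSum_commPath {ω θ : D → ℝ} (hω : ∀ e, ω (X.inv e) = -ω e)
    (hθ : ∀ e, θ (X.inv e) = -θ e) (a b : List D) :
    crossSum ω θ (X.commPath a b) =
      2 * (pathSum ω a * pathSum θ b - pathSum θ a * pathSum ω b) := by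
  simp only [commPath, crossSum_append, pathSum_append, pathSum_revPath hω, pathSum_revPath hθ,
    crossSum_revPath hω hθ]
  ring

/-- Blocks with zero displacement do not interact, so the contributions of the commutators simply
add up. -/
theorem crossSum_flatten {ω θ : D → ℝ} {L : List (List D)} (h : ∀ l ∈ L, pathSum ω l = 0)
    (h' : ∀ l ∈ L, pathSum θ l = 0) :
    crossSum ω θ L.flatten = (L.map (crossSum ω θ)).sum := by
  induction L with
  | nil => rfl
  | cons l L ih =>
    rw [List.flatten_cons, crossSum_append, h l (by simp), h' l (by simp),
      ih (fun m hm => h m (by simp [hm])) (fun m hm => h' m (by simp [hm])), List.map_cons,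
      List.sum_cons]
    ring

/-! ### The Riemann bilinear identity -/

/-- The wedge product of two cochains on the face to the left of an oriented edge. -/
def wedge (X : PolyhedralSurface D) (ω θ : D → ℝ) (e : D) : ℝ :=
  ω e * θ (X.next e) - θ e * ω (X.next e)

theorem wedge_next {ω θ : D → ℝ} (hω : ω ∈ X.closedCochains) (hθ : θ ∈ X.closedCochains)
    (e : D) : X.wedge ω θ (X.next e) = X.wedge ω θ e := by
  have h1 : ω (X.next (X.next e)) = -ω e - ω (X.next e) := by linarith [hω.2 e]
  have h2 : θ (X.next (X.next e)) = -θ e - θ (X.next e) := by linarith [hθ.2 e]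
  simp only [wedge, h1, h2]
  ring

/-- Both sides are twice the signed area of the triangle developed by (ω, θ). -/
theorem crossSum_face {ω θ : D → ℝ} (hω : ω ∈ X.closedCochains) (hθ : θ ∈ X.closedCochains)
    (e : D) : crossSum ω θ [e, X.next e, X.next (X.next e)] = X.wedge ω θ e := by
  have h1 : ω (X.next (X.next e)) = -ω e - ω (X.next e) := by linarith [hω.2 e]
  have h2 : θ (X.next (X.next e)) = -θ e - θ (X.next e) := by linarith [hθ.2 e]
  simp only [wedge, crossSum, pathSum_cons, pathSum_nil, h1, h2]
  ring

theorem crossSum_insert {ω θ : D → ℝ} {k : List D} (h : pathSum ω k = 0) (h' : pathSum θ k = 0)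
    (l m : List D) : crossSum ω θ (l ++ (k ++ m)) = crossSum ω θ (l ++ m) + crossSum ω θ k := by
  simp only [crossSum_append, pathSum_append, h, h']
  ring

/-- A homotopy sweeps every face with some multiplicity `n`. -/
theorem Homotopic.exists_multiplicity [Fintype D] {v : X.Vertex} {l m : List D}
    (h : X.Homotopic v l m) : ∃ n : D → ℝ, (∀ e, n (X.next e) = n e) ∧
      (∀ κ : D → ℝ, (∀ e, κ (X.inv e) = -κ e) →
        pathSum κ l - pathSum κ m = ∑ e, n e * κ e) ∧
      ∀ ω ∈ X.closedCochains, ∀ θ ∈ X.closedCochains,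
        3 * (crossSum ω θ l - crossSum ω θ m) = ∑ e, n e * X.wedge ω θ e := by
  classical
  induction h with
  | rel _ _ h =>
    cases h with
    | spur a e m w ha hm =>
      refine ⟨0, fun _ => rfl, fun κ hκ => ?_, fun ω hω θ hθ => ?_⟩
      · simp [hκ]
      · rw [crossSum_insert (by simp [hω.1]) (by simp [hθ.1])]
        simp only [crossSum, pathSum_cons, pathSum_nil, hω.1, hθ.1, Pi.zero_apply, zero_mul,
          Finset.sum_const_zero]
        ring
    | face a e m w ha hm =>
      -- The multiplicity is a function of faces stored on oriented edges, so each face is counted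
      -- three times; this is the source of the factor 3.
      refine ⟨Pi.single e 1 + Pi.single (X.next e) 1 + Pi.single (X.next (X.next e)) 1,
        fun x => ?_, fun κ hκ => ?_, fun ω hω θ hθ => ?_⟩
      · have key : ∀ x y, (X.next x = y) = (x = X.next (X.next y)) := fun x y =>
          propext ⟨fun h => by rw [← h, X.next_next_next], fun h => by
            rw [h, X.next_next_next]⟩
        simp only [Pi.add_apply, Pi.single_apply, key, X.next_next_next]
        ring
      · simp only [Pi.add_apply, add_mul, Finset.sum_add_distrib, Pi.single_apply, ite_mul,
          one_mul, zero_mul, Finset.sum_ite_eq', Finset.mem_univ, if_true, pathSum_append,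
          pathSum_cons, pathSum_nil]
        ring
      · rw [crossSum_insert (by simpa [add_assoc] using hω.2 e) (by simpa [add_assoc] using hθ.2 e),
          crossSum_face hω hθ]
        simp only [Pi.add_apply, add_mul, Finset.sum_add_distrib, Pi.single_apply, ite_mul,
          one_mul, zero_mul, Finset.sum_ite_eq', Finset.mem_univ, if_true, wedge_next hω hθ]
        ring
  | refl _ => exact ⟨0, fun _ => rfl, fun κ _ => by simp, fun ω _ θ _ => by simp⟩
  | symm _ _ _ ih =>
    obtain ⟨n, h1, h2, h3⟩ := ih
    refine ⟨-n, fun e => by simp [h1], fun κ hκ => ?_, fun ω hω θ hθ => ?_⟩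
    · have := h2 κ hκ
      simp only [Pi.neg_apply, neg_mul, Finset.sum_neg_distrib]; linarith
    · have := h3 ω hω θ hθ
      simp only [Pi.neg_apply, neg_mul, Finset.sum_neg_distrib]; linarith
  | trans _ _ _ _ _ ih1 ih2 =>
    obtain ⟨n, h1, h2, h3⟩ := ih1
    obtain ⟨n', h1', h2', h3'⟩ := ih2
    refine ⟨n + n', fun e => by simp [h1, h1'], fun κ hκ => ?_, fun ω hω θ hθ => ?_⟩
    · have := h2 κ hκ
      have := h2' κ hκ
      simp only [Pi.add_apply, add_mul, Finset.sum_add_distrib]; linarith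
    · have := h3 ω hω θ hθ
      have := h3' ω hω θ hθ
      simp only [Pi.add_apply, add_mul, Finset.sum_add_distrib]; linarith

/-- The target is arbitrary because this serves both for multiplicities and, with values in `Prop`,
for reachability by paths. -/
theorem IsConnected.eq_of_invariant {E : Type*} (hX : X.IsConnected) {n : D → E}
    (hinv : ∀ e, n (X.inv e) = n e) (hnext : ∀ e, n (X.next e) = n e) (e e' : D) :
    n e = n e' := by
  induction hX e e' with
  | rel x y h =>
    rcases h with rfl | rfl
    · exact (hinv _).symm
    · exact (hnext _).symm
  | refl _ => rfl
  | symm _ _ _ ih => exact ih.symm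
  | trans _ _ _ _ _ ih1 ih2 => exact ih1.trans ih2

/-- If a null-homotopic path is a zero chain, then its homotopy to a constant path sweeps all the
faces with the same multiplicity. -/
theorem Homotopic.exists_degree [Fintype D] (hX : X.IsConnected) {v : X.Vertex} {l : List D}
    (h : X.Homotopic v l [])
    (hl : ∀ κ : D → ℝ, (∀ e, κ (X.inv e) = -κ e) → pathSum κ l = 0) :
    ∃ d : ℝ, ∀ ω ∈ X.closedCochains, ∀ θ ∈ X.closedCochains,
      3 * crossSum ω θ l = d * ∑ e, X.wedge ω θ e := by
  classical
  obtain ⟨n, h1, h2, h3⟩ := h.exists_multiplicity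
  have hinv : ∀ x, n (X.inv x) = n x := by
    intro x
    have key : ∀ y z, (X.inv y = z) = (y = X.inv z) := fun y z =>
      propext ⟨fun h => by rw [← h, X.inv_inv], fun h => by rw [h, X.inv_inv]⟩
    -- Testing against the cochain dual to the edge of `x` compares the multiplicities of the two
    -- faces adjacent to it.
    have hκ : ∀ e, (Pi.single x 1 - Pi.single (X.inv x) 1 : D → ℝ) (X.inv e) =
        -(Pi.single x 1 - Pi.single (X.inv x) 1 : D → ℝ) e := by
      intro e
      simp only [Pi.sub_apply, Pi.single_apply, key, X.inv_inv]
      ring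
    have := h2 _ hκ
    rw [hl _ hκ] at this
    simp only [Pi.sub_apply, mul_sub, Finset.sum_sub_distrib, Pi.single_apply, mul_ite,
      mul_one, mul_zero, Finset.sum_ite_eq', Finset.mem_univ, if_true, pathSum_nil] at this
    linarith
  have hconst := hX.eq_of_invariant hinv h1
  rcases isEmpty_or_nonempty D with hD | ⟨⟨e₀⟩⟩
  · refine ⟨0, fun ω hω θ hθ => ?_⟩
    have := h3 ω hω θ hθ
    simpa [crossSum] using this
  · refine ⟨n e₀, fun ω hω θ hθ => ?_⟩
    have := h3 ω hω θ hθ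
    rw [Finset.mul_sum]
    simpa [crossSum, hconst _ e₀] using this

/-- The homotopy class of a closed path. -/
def Pi1.mk {v : X.Vertex} (l : {l : List D // X.IsPath v l v}) : X.Pi1 v := Quotient.mk _ l

theorem Pi1.prod_mk {v : X.Vertex} (L : List {l : List D // X.IsPath v l v}) :
    ∃ h, (L.map Pi1.mk).prod = Pi1.mk ⟨(L.map Subtype.val).flatten, h⟩ := by
  induction L with
  | nil => exact ⟨rfl, rfl⟩
  | cons l L ih =>
    obtain ⟨h, hh⟩ := ih
    refine ⟨l.2.append h, ?_⟩
    rw [List.map_cons, List.prod_cons, hh]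
    rfl

theorem IsStandardBasis.homotopic {v : X.Vertex} {g : ℕ}
    {a b : Fin g → {l : List D // X.IsPath v l v}}
    (h : IsStandardBasis (fun k => Pi1.mk (a k)) fun k => Pi1.mk (b k)) :
    X.Homotopic v (List.ofFn fun k => X.commPath (a k).1 (b k).1).flatten [] := by
  obtain ⟨h', hh⟩ := Pi1.prod_mk (List.ofFn fun k =>
    (⟨X.commPath (a k).1 (b k).1, (((a k).2.append (b k).2).append (a k).2.rev).append (b k).2.rev⟩ :
      {l : List D // X.IsPath v l v}))
  have h2 := h.2
  rw [List.map_ofFn] at hh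
  have h3 := hh.symm.trans h2
  have := Quotient.exact h3
  simp only [List.map_ofFn] at this
  exact this

/-- The Riemann bilinear identity, up to the degree `d` of the standard basis. -/
theorem IsStandardBasis.exists_degree [Fintype D] (hX : X.IsConnected) {v : X.Vertex} {g : ℕ}
    {a b : Fin g → {l : List D // X.IsPath v l v}}
    (h : IsStandardBasis (fun k => Pi1.mk (a k)) fun k => Pi1.mk (b k)) :
    ∃ d : ℝ, ∀ ω ∈ X.closedCochains, ∀ θ ∈ X.closedCochains,
      6 * ∑ k, (pathSum ω (a k).1 * pathSum θ (b k).1 - pathSum θ (a k).1 * pathSum ω (b k).1) =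
        d * ∑ e, X.wedge ω θ e := by
  have h0 : ∀ κ : D → ℝ, (∀ e, κ (X.inv e) = -κ e) →
      ∀ l ∈ List.ofFn fun k => X.commPath (a k).1 (b k).1, pathSum κ l = 0 := by
    intro κ hκ l hl
    obtain ⟨k, rfl⟩ := (List.mem_ofFn' _ _).1 hl
    exact pathSum_commPath hκ _ _
  obtain ⟨d, hd⟩ := h.homotopic.exists_degree hX fun κ hκ => pathSum_flatten_eq_zero (h0 κ hκ)
  refine ⟨d, fun ω hω θ hθ => ?_⟩
  rw [← hd ω hω θ hθ, crossSum_flatten (h0 ω hω.1) (h0 θ hθ.1), List.map_ofFn, List.sum_ofFn,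
    Finset.mul_sum, Finset.mul_sum]
  refine Finset.sum_congr rfl fun k _ => ?_
  rw [Function.comp_apply, crossSum_commPath hω.1 hθ.1]
  ring

/-! ### The Dirichlet energy -/

/-- The law of cosines for the cotangent, where `s` is four times the area. -/
theorem cot_arccos_eq {a b c s : ℝ} (hb : 0 < b) (hc : 0 < c) (hs : 0 < s)
    (h : s ^ 2 = (2 * b * c) ^ 2 - (b ^ 2 + c ^ 2 - a ^ 2) ^ 2) :
    Real.cot (Real.arccos ((b ^ 2 + c ^ 2 - a ^ 2) / (2 * b * c))) =
      (b ^ 2 + c ^ 2 - a ^ 2) / s := by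
  have hbc : 0 < 2 * b * c := by positivity
  have hle : |(b ^ 2 + c ^ 2 - a ^ 2) / (2 * b * c)| ≤ 1 := by
    rw [abs_div, abs_of_pos hbc, div_le_one hbc]
    exact abs_le_of_sq_le_sq (by nlinarith [sq_nonneg s]) hbc.le
  have hsin : √(1 - ((b ^ 2 + c ^ 2 - a ^ 2) / (2 * b * c)) ^ 2) = s / (2 * b * c) := by
    rw [Real.sqrt_eq_iff_mul_self_eq_of_pos (by positivity)]
    field_simp
    linarith
  rw [Real.cot_eq_cos_div_sin, Real.sin_arccos, Real.cos_arccos (abs_le.1 hle).1 (abs_le.1 hle).2,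
    hsin]
  field_simp

/-- The Dirichlet energy of a linear function on a nondegenerate triangle with sides `a`, `b`, `c`
is positive definite. -/
theorem cot_quadratic_pos {a b c x y z : ℝ} (ha : 0 < a) (hb : 0 < b) (hc : 0 < c)
    (h1 : a < b + c) (h2 : b < c + a) (h3 : c < a + b) (hsum : x + y + z = 0)
    (hne : x ≠ 0 ∨ y ≠ 0) :
    0 < Real.cot (Real.arccos ((b ^ 2 + c ^ 2 - a ^ 2) / (2 * b * c))) * x ^ 2 +
      Real.cot (Real.arccos ((c ^ 2 + a ^ 2 - b ^ 2) / (2 * c * a))) * y ^ 2 +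
      Real.cot (Real.arccos ((a ^ 2 + b ^ 2 - c ^ 2) / (2 * a * b))) * z ^ 2 := by
  -- Heron's formula. The expression is symmetric in the sides, so one `s` serves all three angles.
  have hpos : 0 < (2 * b * c) ^ 2 - (b ^ 2 + c ^ 2 - a ^ 2) ^ 2 := by
    have : (2 * b * c) ^ 2 - (b ^ 2 + c ^ 2 - a ^ 2) ^ 2 =
        (a + b + c) * (b + c - a) * (c + a - b) * (a + b - c) := by ring
    rw [this]
    have := sub_pos.2 h1
    have := sub_pos.2 h2
    have := sub_pos.2 h3
    positivity
  obtain ⟨s, hs, hss⟩ : ∃ s : ℝ, 0 < s ∧ s ^ 2 = (2 * b * c) ^ 2 - (b ^ 2 + c ^ 2 - a ^ 2) ^ 2 :=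
    ⟨_, Real.sqrt_pos.2 hpos, Real.sq_sqrt hpos.le⟩
  rw [cot_arccos_eq hb hc hs hss, cot_arccos_eq hc ha hs (by rw [hss]; ring),
    cot_arccos_eq ha hb hs (by rw [hss]; ring)]
  have hz : z = -x - y := by linarith
  subst hz
  have hq : 0 < b ^ 2 * x ^ 2 + a ^ 2 * y ^ 2 + x * y * (a ^ 2 + b ^ 2 - c ^ 2) := by
    have hid : 4 * a ^ 2 * b ^ 2 * x ^ 2 - (a ^ 2 + b ^ 2 - c ^ 2) ^ 2 * x ^ 2 = s ^ 2 * x ^ 2 := by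
      rw [hss]; ring
    -- Completing the square in y; the remaining coefficient of x² is s².
    have hsq : 4 * a ^ 2 * (b ^ 2 * x ^ 2 + a ^ 2 * y ^ 2 + x * y * (a ^ 2 + b ^ 2 - c ^ 2)) =
        (2 * a ^ 2 * y + x * (a ^ 2 + b ^ 2 - c ^ 2)) ^ 2 + s ^ 2 * x ^ 2 := by
      rw [← hid]; ring
    have : 0 < (2 * a ^ 2 * y + x * (a ^ 2 + b ^ 2 - c ^ 2)) ^ 2 + s ^ 2 * x ^ 2 := by
      rcases eq_or_ne x 0 with rfl | hx
      · have hy : y ≠ 0 := by simpa using hne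
        have : (2 * a ^ 2 * y + 0 * (a ^ 2 + b ^ 2 - c ^ 2)) ^ 2 + s ^ 2 * 0 ^ 2 =
          4 * a ^ 4 * y ^ 2 := by ring
        rw [this]; positivity
      · positivity
    rw [← hsq] at this
    exact pos_of_mul_pos_right this (by positivity)
  have : (b ^ 2 + c ^ 2 - a ^ 2) / s * x ^ 2 + (c ^ 2 + a ^ 2 - b ^ 2) / s * y ^ 2 +
      (a ^ 2 + b ^ 2 - c ^ 2) / s * (-x - y) ^ 2 =
      2 * (b ^ 2 * x ^ 2 + a ^ 2 * y ^ 2 + x * y * (a ^ 2 + b ^ 2 - c ^ 2)) / s := by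
    field_simp; ring
  rw [this]
  positivity

theorem cot_oppAngle_pos {ω : D → ℝ} (hω : ω ∈ X.closedCochains) {e : D} (he : ω e ≠ 0) :
    0 < Real.cot (X.oppAngle e) * ω e ^ 2 + Real.cot (X.oppAngle (X.next e)) * ω (X.next e) ^ 2 +
      Real.cot (X.oppAngle (X.next (X.next e))) * ω (X.next (X.next e)) ^ 2 := by
  have h2 := X.len_triangle (X.next e)
  have h3 := X.len_triangle (X.next (X.next e))
  simp only [X.next_next_next] at h2 h3
  have := cot_quadratic_pos (X.len_pos e) (X.len_pos _) (X.len_pos _) (X.len_triangle e) h2 h3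
    (hω.2 e) (Or.inl he)
  simpa only [oppAngle, X.next_next_next] using this

theorem weight_inv (e : D) : X.weight (X.inv e) = X.weight e := by
  simp only [weight, X.inv_inv]; ring

theorem sum_comp_inv [Fintype D] (X : PolyhedralSurface D) (F : D → ℝ) :
    ∑ e, F (X.inv e) = ∑ e, F e :=
  Equiv.sum_comp (Function.Involutive.toPerm X.inv X.inv_inv) F

theorem sum_comp_next [Fintype D] (X : PolyhedralSurface D) (F : D → ℝ) :
    ∑ e, F (X.next e) = ∑ e, F e := Equiv.sum_comp X.facePerm F

/-- The Dirichlet energy is positive definite on closed cochains. -/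
theorem eq_zero_of_energy_eq_zero [Fintype D] {ω : D → ℝ} (hω : ω ∈ X.closedCochains)
    (h : ∑ e, ω e * (X.weight e * ω e) = 0) : ω = 0 := by
  set q : D → ℝ := fun e => Real.cot (X.oppAngle e) * ω e ^ 2 with hq
  have h1 : ∑ e, ω e * (X.weight e * ω e) = ∑ e, q e := by
    have : ∀ e, ω e * (X.weight e * ω e) = 1 / 2 * q e + 1 / 2 * q (X.inv e) := by
      intro e
      simp only [hq, weight, hω.1]; ring
    simp only [this, Finset.sum_add_distrib, ← Finset.mul_sum, X.sum_comp_inv q]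
    ring
  -- The half-cotangents are regrouped from edges to faces, where positivity is available.
  have h2 : ∑ e, (q e + q (X.next e) + q (X.next (X.next e))) = 3 * ∑ e, q e := by
    simp only [Finset.sum_add_distrib, X.sum_comp_next fun e => q (X.next e), X.sum_comp_next q]
    ring
  rw [← h1, h, mul_zero] at h2
  by_contra hne
  obtain ⟨e, he⟩ := Function.ne_iff.1 hne
  refine h2.not_gt (Finset.sum_pos' (fun x _ => ?_) ⟨e, Finset.mem_univ _, cot_oppAngle_pos hω he⟩)
  rcases eq_or_ne (ω x) 0 with h0 | h0
  · rcases eq_or_ne (ω (X.next x)) 0 with h0' | h0'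
    · have := hω.2 x
      have h0'' : ω (X.next (X.next x)) = 0 := by linarith
      simp [hq, h0, h0', h0'']
    · have := cot_oppAngle_pos hω h0'
      simp only [X.next_next_next] at this
      simp only [hq]; linarith
  · exact (cot_oppAngle_pos hω h0).le

/-! ### Cochains of the dual cell decomposition -/

/-- The dual cochains with zero sums around the vertices. -/
def IsCoclosed (X : PolyhedralSurface D) (η : D → ℝ) : Prop :=
  ∀ e, ∑ j ∈ Finset.range (orderOf X.vertexPerm), η ((X.vertexPerm ^ j) e) = 0

/-- A function `c` on the corners such that `η e = c e - c (σ e)` for the rotation `σ` about the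
tail of `e`, if `η` is coclosed. -/
noncomputable def cornerMap (X : PolyhedralSurface D) : (D → ℝ) →ₗ[ℝ] (D → ℝ) :=
  -(orderOf X.vertexPerm : ℝ)⁻¹ • ∑ j ∈ Finset.range (orderOf X.vertexPerm),
    (j : ℝ) • LinearMap.funLeft ℝ ℝ (X.vertexPerm ^ j)

/-- Summation by parts around a vertex. Taking the order N of the whole rotation, a multiple of
every vertex degree, gives one formula for all vertices that is linear in η. -/
theorem cornerMap_sub_cornerMap [Finite D] {η : D → ℝ} (hη : X.IsCoclosed η) (e : D) :
    X.cornerMap η e - X.cornerMap η (X.next (X.inv e)) = η e := by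
  set N := orderOf X.vertexPerm with hN
  have hN0 : (N : ℝ) ≠ 0 := Nat.cast_ne_zero.2 (orderOf_pos X.vertexPerm).ne'
  have hc : ∀ x, X.cornerMap η x = -(N : ℝ)⁻¹ * ∑ j ∈ Finset.range N,
      (j : ℝ) * η ((X.vertexPerm ^ j) x) := by
    intro x
    simp [cornerMap, ← hN, LinearMap.funLeft_apply]
  -- After the shift, the term j = 0 vanishes and the new term j = N is N η(e), as the N-th power of
  -- the rotation is the identity.
  have hs : ∑ j ∈ Finset.range N, ((j : ℝ) + 1) * η ((X.vertexPerm ^ (j + 1)) e) =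
      ∑ j ∈ Finset.range N, (j : ℝ) * η ((X.vertexPerm ^ j) e) + N * η e := by
    have := Finset.sum_range_succ' (fun j : ℕ => (j : ℝ) * η ((X.vertexPerm ^ j) e)) N
    rw [Finset.sum_range_succ, hN, pow_orderOf_eq_one, ← hN] at this
    simp only [Nat.cast_add, Nat.cast_one, Nat.cast_zero, zero_mul, add_zero,
      Equiv.Perm.one_apply] at this
    exact this.symm
  have hs1 : ∑ j ∈ Finset.range N, η ((X.vertexPerm ^ (j + 1)) e) = 0 := by
    have := hη (X.vertexPerm e)
    simpa only [← hN, pow_succ, Equiv.Perm.mul_apply] using this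
  have hσ : ∑ j ∈ Finset.range N, (j : ℝ) * η ((X.vertexPerm ^ j) (X.next (X.inv e))) =
      ∑ j ∈ Finset.range N, (j : ℝ) * η ((X.vertexPerm ^ j) e) + N * η e := by
    rw [← hs, ← sub_eq_zero, ← Finset.sum_sub_distrib, ← neg_eq_zero, ← hs1,
      ← Finset.sum_neg_distrib]
    refine Finset.sum_congr rfl fun j _ => ?_
    have : (X.vertexPerm ^ (j + 1)) e = (X.vertexPerm ^ j) (X.next (X.inv e)) := by
      rw [pow_succ, Equiv.Perm.mul_apply]; rfl
    rw [this]; ring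
  rw [hc, hc, hσ]
  field_simp
  ring

/-- A closed cochain homologous to a closed dual cochain `η`. -/
noncomputable def primalMap (X : PolyhedralSurface D) : (D → ℝ) →ₗ[ℝ] (D → ℝ) :=
  (LinearMap.id - LinearMap.funLeft ℝ ℝ X.next) ∘ₗ X.cornerMap

theorem primalMap_apply (η : D → ℝ) (e : D) :
    X.primalMap η e = X.cornerMap η e - X.cornerMap η (X.next e) := by
  simp [primalMap, LinearMap.funLeft_apply]

/-- Sums over faces telescope. On the two orientations of an edge the same four corner values occur
in θ(e) + θ(inv e) and in η(e) + η(inv e) = 0. -/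
theorem primalMap_mem [Finite D] {η : D → ℝ} (hη : X.IsCoclosed η)
    (hinv : ∀ e, η (X.inv e) = -η e) : X.primalMap η ∈ X.closedCochains := by
  refine ⟨fun e => ?_, fun e => ?_⟩
  · have h1 := cornerMap_sub_cornerMap hη e
    have h2 := cornerMap_sub_cornerMap hη (X.inv e)
    rw [X.inv_inv, hinv] at h2
    rw [primalMap_apply, primalMap_apply]
    linarith
  · simp only [primalMap_apply, X.next_next_next]
    ring

/-- The wedge product of a closed cochain and a closed dual cochain, in two ways. -/
theorem sum_wedge_primalMap [Fintype D] {ω η : D → ℝ} (hω : ω ∈ X.closedCochains)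
    (hη : X.IsCoclosed η) : ∑ e, X.wedge ω (X.primalMap η) e = 3 * ∑ e, ω e * η e := by
  set c := X.cornerMap η
  have hc : ∀ e, η e = c e - c (X.next (X.inv e)) := fun e => (cornerMap_sub_cornerMap hη e).symm
  have h1 : ∑ e, ω e * η e = ∑ e, ω e * c e + ∑ e, ω e * c (X.next e) := by
    have := X.sum_comp_inv fun e => ω e * c (X.next (X.inv e))
    simp only [X.inv_inv, hω.1, neg_mul, Finset.sum_neg_distrib] at this
    simp only [hc, mul_sub, Finset.sum_sub_distrib]
    linarith
  have h2 := X.sum_comp_next fun e => ω e * c e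
  have h3 := X.sum_comp_next fun e => ω (X.next (X.next e)) * c e
  have h5 := X.sum_comp_next fun e => ω e * c (X.next (X.next e))
  simp only [X.next_next_next] at h3 h5
  -- Closedness of ω, weighted by c, eliminates the third of the sums ∑ ω(e) c(nextⁱ e); what
  -- remains is three times the right-hand side of `h1`.
  have h6 : ∑ e, ω e * c e + ∑ e, ω (X.next e) * c e + ∑ e, ω (X.next (X.next e)) * c e = 0 := by
    rw [← Finset.sum_add_distrib, ← Finset.sum_add_distrib]
    refine Finset.sum_eq_zero fun e _ => ?_
    rw [← add_mul, ← add_mul, hω.2, zero_mul]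
  have hw : ∀ e, X.wedge ω (X.primalMap η) e = ω e * c (X.next e) -
      ω e * c (X.next (X.next e)) - ω (X.next e) * c e + ω (X.next e) * c (X.next e) := by
    intro e
    simp only [wedge, primalMap_apply, c]
    ring
  simp only [hw, Finset.sum_add_distrib, Finset.sum_sub_distrib]
  linarith

/-! ### Harmonic cochains -/

theorem eq_of_sameCycle {E F : Type*} {σ : Equiv.Perm E} {f : E → F} (h : ∀ x, f (σ x) = f x)
    {x y : E} (hxy : σ.SameCycle x y) : f x = f y := by
  have hn : ∀ (n : ℕ) (z : E), f ((σ ^ n) z) = f z := by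
    intro n
    induction n with
    | zero => intro z; rfl
    | succ n ih => intro z; rw [pow_succ, Equiv.Perm.mul_apply, ih, h]
  obtain ⟨i, rfl⟩ := hxy
  obtain ⟨n, rfl | rfl⟩ := i.eq_nat_or_neg
  · rw [zpow_natCast, hn]
  · rw [← hn n ((σ ^ (-(n : ℤ))) x), ← Equiv.Perm.mul_apply, ← zpow_natCast, ← zpow_add]
    simp

theorem exists_vertex_function {E : Type*} {f : D → E} (h : ∀ e, f (X.next (X.inv e)) = f e) :
    ∃ u : X.Vertex → E, ∀ e, u (X.tail e) = f e :=
  ⟨Quotient.lift f fun _ _ => eq_of_sameCycle (σ := X.vertexPerm) h, fun _ => rfl⟩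

theorem exists_face_function {E : Type*} {f : D → E} (h : ∀ e, f (X.next e) = f e) :
    ∃ u : X.Face → E, ∀ e, u (X.left e) = f e :=
  ⟨Quotient.lift f fun _ _ => eq_of_sameCycle (σ := X.facePerm) h, fun _ => rfl⟩

/-- Use the vertex sum P of η itself as the test function: antisymmetry turns the hypothesis into ∑
η P = 0, while ∑ P² = N ∑ η P. -/
theorem isCoclosed_of_orthogonal [Fintype D] {η : D → ℝ} (hinv : ∀ e, η (X.inv e) = -η e)
    (h : ∀ u, ∑ e, η e * X.coboundary u e = 0) : X.IsCoclosed η := by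
  set N := orderOf X.vertexPerm with hN
  set P : D → ℝ := fun e => ∑ j ∈ Finset.range N, η ((X.vertexPerm ^ j) e) with hP
  have hPσ : ∀ e, P (X.vertexPerm e) = P e := by
    intro e
    have h1 : P (X.vertexPerm e) = ∑ j ∈ Finset.range N, η ((X.vertexPerm ^ (j + 1)) e) := by
      simp only [hP, pow_succ, Equiv.Perm.mul_apply]
    have h2 := Finset.sum_range_succ' (fun j => η ((X.vertexPerm ^ j) e)) N
    rw [Finset.sum_range_succ, hN, pow_orderOf_eq_one, pow_zero, ← hN] at h2
    rw [h1]
    exact (add_right_cancel h2).symm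
  have hPpow : ∀ (j : ℕ) e, P ((X.vertexPerm ^ j) e) = P e := by
    intro j
    induction j with
    | zero => intro e; rfl
    | succ j ih => intro e; rw [pow_succ, Equiv.Perm.mul_apply, ih, hPσ]
  obtain ⟨u, hu⟩ := exists_vertex_function hPσ
  have h0 : ∑ e, η e * P e = 0 := by
    have h1 := h u
    have h2 := X.sum_comp_inv fun e => η e * P e
    simp only [hinv, neg_mul, Finset.sum_neg_distrib] at h2
    have h3 : ∀ e, X.coboundary u e = P (X.inv e) - P e := fun e => by
      rw [← hu, ← hu]; rfl
    simp only [h3, mul_sub, Finset.sum_sub_distrib] at h1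
    linarith
  have h1 : ∑ e, P e * P e = 0 := by
    have : ∀ e, P e * P e = ∑ j ∈ Finset.range N,
        η ((X.vertexPerm ^ j) e) * P ((X.vertexPerm ^ j) e) := by
      intro e
      simp only [hPpow]
      rw [← Finset.sum_mul]
    simp only [this]
    rw [Finset.sum_comm]
    refine Finset.sum_eq_zero fun j _ => ?_
    rw [← h0]
    exact Equiv.sum_comp (X.vertexPerm ^ j) fun e => η e * P e
  intro e
  exact mul_self_eq_zero.1
    ((Finset.sum_eq_zero_iff_of_nonneg fun x _ => mul_self_nonneg (P x)).1 h1 e (Finset.mem_univ e))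

theorem IsConnected.exists_isPath (hX : X.IsConnected) (v w : X.Vertex) :
    ∃ l, X.IsPath v l w := by
  obtain ⟨e₀, rfl⟩ : ∃ e, X.tail e = v := Quotient.exists_rep v
  obtain ⟨e, rfl⟩ : ∃ e, X.tail e = w := Quotient.exists_rep w
  have step : ∀ e, (∃ l, X.IsPath (X.tail e₀) l (X.tail e)) →
      ∃ l, X.IsPath (X.tail e₀) l (X.head e) := fun e ⟨l, hl⟩ => ⟨l ++ [e], hl.append ⟨rfl, rfl⟩⟩
  have hinv : ∀ e, (∃ l, X.IsPath (X.tail e₀) l (X.tail (X.inv e))) =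
      ∃ l, X.IsPath (X.tail e₀) l (X.tail e) := fun e =>
    propext ⟨fun h => by simpa only [head_inv] using step _ h, step e⟩
  have := hX.eq_of_invariant (n := fun e => ∃ l, X.IsPath (X.tail e₀) l (X.tail e)) hinv
    (fun e => by rw [tail_next]; exact hinv e) e₀ e
  exact this.mp ⟨[], rfl⟩

theorem pathSum_eq_zero_of_generators {ω : D → ℝ} (hω : ω ∈ X.closedCochains) {v : X.Vertex}
    {S : Set {l : List D // X.IsPath v l v}} (hS : Subgroup.closure (Pi1.mk '' S) = ⊤)
    (h : ∀ l ∈ S, pathSum ω l.1 = 0) (l : List D) (hl : X.IsPath v l v) : pathSum ω l = 0 := by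
  have hmk : ∀ l m : {l : List D // X.IsPath v l v}, Pi1.mk l = Pi1.mk m →
      pathSum ω l.1 = pathSum ω m.1 := fun l m h => pathSum_eq_of_homotopic hω (Quotient.exact h)
  suffices ∀ γ ∈ Subgroup.closure (Pi1.mk '' S), ∀ l : {l : List D // X.IsPath v l v},
      Pi1.mk l = γ → pathSum ω l.1 = 0 from this (Pi1.mk ⟨l, hl⟩) (hS ▸ Subgroup.mem_top _) ⟨l, hl⟩ rfl
  intro γ hγ
  induction hγ using Subgroup.closure_induction with
  | mem γ hγ =>
    obtain ⟨m, hm, rfl⟩ := hγ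
    intro l hl
    rw [hmk l m hl, h m hm]
  | one => exact fun l hl => hmk l ⟨[], rfl⟩ hl
  | mul γ γ' _ _ ih ih' =>
    obtain ⟨m, rfl⟩ : ∃ m, Pi1.mk m = γ := Quotient.exists_rep γ
    obtain ⟨m', rfl⟩ : ∃ m, Pi1.mk m = γ' := Quotient.exists_rep γ'
    intro l hl
    rw [hmk l ⟨m.1 ++ m'.1, m.2.append m'.2⟩ hl, pathSum_append, ih m rfl, ih' m' rfl, add_zero]
  | inv γ _ ih =>
    obtain ⟨m, rfl⟩ : ∃ m, Pi1.mk m = γ := Quotient.exists_rep γ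
    intro l hl
    rw [hmk l ⟨X.revPath m.1, m.2.rev⟩ hl, pathSum_revPath hω.1, ih m rfl, neg_zero]

/-- A cochain with zero sums along closed paths is exact. -/
theorem mem_range_coboundary (hX : X.IsConnected) {ω : D → ℝ} (hω : ω ∈ X.closedCochains)
    (v : X.Vertex) (h : ∀ l, X.IsPath v l v → pathSum ω l = 0) :
    ω ∈ LinearMap.range X.coboundary := by
  choose p hp using hX.exists_isPath v
  refine ⟨fun w => pathSum ω (p w), funext fun e => ?_⟩
  have := h (p (X.tail e) ++ ([e] ++ X.revPath (p (X.head e))))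
    ((hp _).append (IsPath.append ⟨rfl, rfl⟩ (hp (X.head e)).rev))
  simp only [pathSum_append, pathSum_cons, pathSum_nil, pathSum_revPath hω.1] at this
  change pathSum ω (p (X.head e)) - pathSum ω (p (X.tail e)) = ω e
  linarith

theorem range_coboundary_le : LinearMap.range X.coboundary ≤ X.closedCochains := by
  rintro _ ⟨u, rfl⟩
  refine ⟨fun e => ?_, fun e => ?_⟩
  · change u (X.head (X.inv e)) - u (X.tail (X.inv e)) = -(u (X.head e) - u (X.tail e))
    rw [head_inv]
    change _ - u (X.head e) = _
    ring
  · change u (X.head e) - u (X.tail e) + (u (X.head (X.next e)) - u (X.tail (X.next e))) +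
      (u (X.head (X.next (X.next e))) - u (X.tail (X.next (X.next e)))) = 0
    rw [tail_next, tail_next, head_next_next]
    ring

theorem HasGenus.finrank_closedCochains [Finite D] {g : ℕ} (h : X.HasGenus g) :
    Module.finrank ℝ X.closedCochains =
      Module.finrank ℝ (LinearMap.range X.coboundary) + 2 * g := by
  have h1 := Submodule.finrank_quotient_add_finrank
    ((LinearMap.range X.coboundary).submoduleOf X.closedCochains)
  rw [h, (Submodule.submoduleOfEquivOfLe range_coboundary_le).finrank_eq] at h1
  omega

/-- The sum along a path as a linear functional. -/
def pathSumₗ (l : List D) : (D → ℝ) →ₗ[ℝ] ℝ where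
  toFun ω := pathSum ω l
  map_add' ω θ := by
    induction l with
    | nil => simp
    | cons e l ih => simp only [pathSum_cons, ih, Pi.add_apply]; ring
  map_smul' c ω := by
    induction l with
    | nil => simp
    | cons e l ih =>
      simp only [pathSum_cons, ih, Pi.smul_apply, smul_eq_mul, RingHom.id_apply]; ring

theorem pathSumₗ_apply (l : List D) (ω : D → ℝ) : pathSumₗ l ω = pathSum ω l := rfl

/-- Every collection of periods is realized by a closed cochain. -/
theorem exists_closed_of_periods [Finite D] (hX : X.IsConnected) {g : ℕ} (hgenus : X.HasGenus g)
    {v : X.Vertex} {a b : Fin g → {l : List D // X.IsPath v l v}}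
    (h : IsStandardBasis (fun k => Pi1.mk (a k)) fun k => Pi1.mk (b k)) (A B : Fin g → ℝ) :
    ∃ ω ∈ X.closedCochains, (∀ k, pathSum ω (a k).1 = A k) ∧ ∀ k, pathSum ω (b k).1 = B k := by
  let P : X.closedCochains →ₗ[ℝ] (Fin g → ℝ) × (Fin g → ℝ) :=
    ((LinearMap.pi fun k => pathSumₗ (a k).1).prod (LinearMap.pi fun k => pathSumₗ (b k).1)) ∘ₗ
      X.closedCochains.subtype
  -- A closed cochain without periods on generators is exact; hence the rank of the period map is at
  -- least 2g, the dimension of the target.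
  have hker : P.ker ≤ (LinearMap.range X.coboundary).submoduleOf X.closedCochains := by
    intro ω hω
    have h1 : ∀ k, pathSum ω.1 (a k).1 = 0 := fun k => congrFun (congrArg Prod.fst hω) k
    have h2 : ∀ k, pathSum ω.1 (b k).1 = 0 := fun k => congrFun (congrArg Prod.snd hω) k
    refine mem_range_coboundary hX ω.2 v
      (pathSum_eq_zero_of_generators ω.2 (S := Set.range a ∪ Set.range b) ?_ ?_)
    · rw [Set.image_union, ← Set.range_comp, ← Set.range_comp]
      exact h.1
    · rintro _ (⟨k, rfl⟩ | ⟨k, rfl⟩)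
      exacts [h1 k, h2 k]
  have h1 := P.finrank_range_add_finrank_ker
  have h2 := Submodule.finrank_mono hker
  rw [(Submodule.submoduleOfEquivOfLe range_coboundary_le).finrank_eq] at h2
  rw [hgenus.finrank_closedCochains] at h1
  have h3 : Module.finrank ℝ ((Fin g → ℝ) × (Fin g → ℝ)) = 2 * g := by simp; omega
  have h4 := P.range.finrank_le
  have h5 : P.range = ⊤ := Submodule.eq_top_of_finrank_eq (by omega)
  obtain ⟨ω, hω⟩ := LinearMap.range_eq_top.1 h5 (A, B)
  exact ⟨ω.1, ω.2, fun k => congrFun (congrArg Prod.fst hω) k,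
    fun k => congrFun (congrArg Prod.snd hω) k⟩

/-- The Hodge star, taking cochains to dual cochains. -/
noncomputable def hodge (X : PolyhedralSurface D) : (D → ℝ) →ₗ[ℝ] (D → ℝ) :=
  LinearMap.pi fun e => X.weight e • LinearMap.proj e

theorem hodge_apply (ω : D → ℝ) (e : D) : X.hodge ω e = X.weight e * ω e := rfl

theorem hodge_inv {ω : D → ℝ} (hω : ∀ e, ω (X.inv e) = -ω e) (e : D) :
    X.hodge ω (X.inv e) = -X.hodge ω e := by
  rw [hodge_apply, hodge_apply, weight_inv, hω]; ring

/-- A harmonic cochain with vanishing A-periods (of itself and of its conjugate) vanishes. -/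
theorem IsStandardBasis.eq_zero_of_harmonic [Finite D] (hX : X.IsConnected) {g : ℕ} (hg : 1 ≤ g)
    (hgenus : X.HasGenus g) {v : X.Vertex} {a b : Fin g → {l : List D // X.IsPath v l v}}
    (h : IsStandardBasis (fun k => Pi1.mk (a k)) fun k => Pi1.mk (b k)) {ω : D → ℝ}
    (hω : ω ∈ X.closedCochains) (hη : X.IsCoclosed (X.hodge ω))
    (h1 : ∀ k, pathSum ω (a k).1 = 0) (h2 : ∀ k, pathSum (X.primalMap (X.hodge ω)) (a k).1 = 0) :
    ω = 0 := by
  cases nonempty_fintype D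
  obtain ⟨d, hd⟩ := h.exists_degree hX
  -- Two closed cochains, one with a single unit A-period and the other with the matching unit
  -- B-period, make the left-hand side of the identity equal to 6.
  have hd0 : d ≠ 0 := by
    rintro rfl
    obtain ⟨ξ, hξ, hξa, hξb⟩ := exists_closed_of_periods hX hgenus h (Pi.single ⟨0, hg⟩ 1) 0
    obtain ⟨ζ, hζ, hζa, hζb⟩ := exists_closed_of_periods hX hgenus h 0 (Pi.single ⟨0, hg⟩ 1)
    have := hd ξ hξ ζ hζ
    simp [hξa, hξb, hζa, hζb, Pi.single_apply] at this
  -- Each product in the identity contains an A-period, so the left-hand side vanishes and the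
  -- energy is zero.
  have := hd ω hω _ (primalMap_mem hη (hodge_inv hω.1))
  rw [sum_wedge_primalMap hω hη] at this
  simp only [h1, h2, zero_mul, sub_zero, Finset.sum_const_zero, mul_zero, zero_eq_mul, hd0,
    false_or] at this
  exact eq_zero_of_energy_eq_zero hω (by simpa [hodge_apply] using this)

/-- Existence of a harmonic cochain with given A-periods (of itself and of its conjugate). -/
theorem IsStandardBasis.exists_harmonic [Finite D] (hX : X.IsConnected) {g : ℕ} (hg : 1 ≤ g)
    (hgenus : X.HasGenus g) {v : X.Vertex} {a b : Fin g → {l : List D // X.IsPath v l v}}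
    (h : IsStandardBasis (fun k => Pi1.mk (a k)) fun k => Pi1.mk (b k)) (A A' : Fin g → ℝ) :
    ∃ ω ∈ X.closedCochains, X.IsCoclosed (X.hodge ω) ∧ (∀ k, pathSum ω (a k).1 = A k) ∧
      ∀ k, pathSum (X.primalMap (X.hodge ω)) (a k).1 = A' k := by
  cases nonempty_fintype D
  let Q : (D → ℝ) →ₗ[ℝ] (D → ℝ) →ₗ[ℝ] ℝ := LinearMap.mk₂ ℝ (fun ω θ => ∑ e, X.hodge ω e * θ e)
    (fun ω ω' θ => by simp [add_mul, Finset.sum_add_distrib])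
    (fun c ω θ => by simp [mul_assoc, Finset.mul_sum])
    (fun ω θ θ' => by simp [mul_add, Finset.sum_add_distrib])
    (fun c ω θ => by simp [mul_left_comm, Finset.mul_sum])
  -- The first component pairs `hodge` ω with exact cochains; its vanishing means that `hodge` ω is
  -- coclosed. The other two are the A-periods.
  let Φ : X.closedCochains →ₗ[ℝ]
      Module.Dual ℝ (LinearMap.range X.coboundary) × ((Fin g → ℝ) × (Fin g → ℝ)) :=
    (Q.domRestrict₁₂ X.closedCochains (LinearMap.range X.coboundary)).prod
      (((LinearMap.pi fun k => pathSumₗ (a k).1).prod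
        ((LinearMap.pi fun k => pathSumₗ (a k).1) ∘ₗ X.primalMap ∘ₗ X.hodge)) ∘ₗ
          X.closedCochains.subtype)
  have hco : ∀ ω : X.closedCochains, (Φ ω).1 = 0 → X.IsCoclosed (X.hodge ω.1) := fun ω hω =>
    isCoclosed_of_orthogonal (hodge_inv ω.2.1) fun u =>
      LinearMap.congr_fun hω ⟨X.coboundary u, LinearMap.mem_range_self _ u⟩
  have hinj : Function.Injective Φ := by
    refine (injective_iff_map_eq_zero Φ).2 fun ω hω => Subtype.ext ?_
    exact h.eq_zero_of_harmonic hX hg hgenus ω.2 (hco ω (congrArg Prod.fst hω))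
      (fun k => congrFun (congrArg (fun x => x.2.1) hω) k)
      fun k => congrFun (congrArg (fun x => x.2.2) hω) k
  have hsurj : Function.Surjective Φ := by
    refine (LinearMap.injective_iff_surjective_of_finrank_eq_finrank ?_).1 hinj
    rw [hgenus.finrank_closedCochains, Module.finrank_prod, Subspace.dual_finrank_eq]
    simp only [Module.finrank_prod, Module.finrank_fin_fun]
    omega
  obtain ⟨ω, hω⟩ := hsurj (0, (A, A'))
  exact ⟨ω.1, ω.2, hco ω (congrArg Prod.fst hω),
    fun k => congrFun (congrArg (fun x => x.2.1) hω) k,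
    fun k => congrFun (congrArg (fun x => x.2.2) hω) k⟩

/-! ### Functions on the universal covering -/

/-- The oriented edge of the universal covering given by an edge path from the base vertex and
an oriented edge. -/
def CoverDart.mk {v : X.Vertex} (l : List D) (e : D) (h : X.IsPath v l (X.tail e)) :
    X.CoverDart v := Quotient.mk _ ⟨(l, e), h⟩

theorem CoverDart.exists_mk {v : X.Vertex} (x : X.CoverDart v) : ∃ l e h, CoverDart.mk l e h = x := by
  obtain ⟨⟨⟨l, e⟩, h⟩⟩ := x
  exact ⟨l, e, h, rfl⟩

theorem deck_mk {v : X.Vertex} (a : {l : List D // X.IsPath v l v}) (l : List D) (e : D)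
    (h : X.IsPath v l (X.tail e)) :
    deck (Pi1.mk a) (CoverDart.mk l e h) = CoverDart.mk (a.1 ++ l) e (a.2.append h) := rfl

theorem universalCover_inv_mk {v : X.Vertex} (l : List D) (e : D) (h : X.IsPath v l (X.tail e)) :
    (X.universalCover v).inv (CoverDart.mk l e h) =
      CoverDart.mk (l ++ [e]) (X.inv e) (h.append ⟨rfl, rfl⟩) := rfl

theorem universalCover_next_mk {v : X.Vertex} (l : List D) (e : D) (h : X.IsPath v l (X.tail e)) :
    (X.universalCover v).next (CoverDart.mk l e h) =
      CoverDart.mk (l ++ [e]) (X.next e) (h.append ⟨rfl, (tail_next e).symm⟩) := rfl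

theorem weight_universalCover {v : X.Vertex} (x : X.CoverDart v) :
    (X.universalCover v).weight x = X.weight (X.proj v x) := by
  have hinv : ∀ x, X.proj v ((X.universalCover v).inv x) = X.inv (X.proj v x) :=
    proj_coverInv v
  have hnext : ∀ x, X.proj v ((X.universalCover v).next x) = X.next (X.proj v x) :=
    proj_coverNext v
  have hlen : ∀ x, (X.universalCover v).len x = X.len (X.proj v x) := fun _ => rfl
  simp only [weight, oppAngle, hlen, hinv, hnext]

theorem CoverDart.exists_function {E : Type*} {v : X.Vertex} (F : List D → D → E)
    (hF : ∀ l m e, X.Homotopic v l m → F l e = F m e) :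
    ∃ f : X.CoverDart v → E, ∀ l e h, f (CoverDart.mk l e h) = F l e :=
  ⟨Quotient.lift (fun p => F p.1.1 p.1.2) (by
    rintro ⟨⟨l, e⟩, hl⟩ ⟨⟨m, e'⟩, hm⟩ ⟨h, rfl⟩
    exact hF l m e h), fun _ _ _ => rfl⟩

/-- A closed cochain is the differential of a function on the vertices of the universal covering. -/
theorem exists_primitive {ω : D → ℝ} (hω : ω ∈ X.closedCochains) (v : X.Vertex) :
    ∃ u : (X.universalCover v).Vertex → ℝ,
      ∀ l e h, u ((X.universalCover v).tail (CoverDart.mk l e h)) = pathSum ω l := by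
  obtain ⟨f, hf⟩ := CoverDart.exists_function (v := v) (fun l (_ : D) => pathSum ω l)
    fun l m _ h => pathSum_eq_of_homotopic hω h
  obtain ⟨u, hu⟩ := exists_vertex_function (X := X.universalCover v) (f := f) (by
    intro x
    obtain ⟨l, e, h, rfl⟩ := x.exists_mk
    rw [universalCover_inv_mk, universalCover_next_mk, hf, hf]
    simp [hω.1])
  exact ⟨u, fun l e h => (hu _).trans (hf l e h)⟩

/-- Passing to the next corner of the face adds θ(e) to the path sum and lowers c by the same
amount. -/
theorem exists_dual_primitive {θ c : D → ℝ} (hθ : θ ∈ X.closedCochains)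
    (hc : ∀ e, θ e = c e - c (X.next e)) (v : X.Vertex) :
    ∃ w : (X.universalCover v).Face → ℝ,
      ∀ l e h, w ((X.universalCover v).left (CoverDart.mk l e h)) = pathSum θ l + c e := by
  obtain ⟨f, hf⟩ := CoverDart.exists_function (v := v) (fun l e => pathSum θ l + c e)
    fun l m _ h => by rw [pathSum_eq_of_homotopic hθ h]
  obtain ⟨w, hw⟩ := exists_face_function (X := X.universalCover v) (f := f) (by
    intro x
    obtain ⟨l, e, h, rfl⟩ := x.exists_mk
    rw [universalCover_next_mk, hf, hf, pathSum_append, pathSum_cons, pathSum_nil, hc]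
    ring)
  exact ⟨w, fun l e h => (hw _).trans (hf l e h)⟩

/-- The discrete analytic function on the universal covering with given harmonic differential. -/
theorem exists_analytic [Finite D] {ω : D → ℝ} (hω : ω ∈ X.closedCochains)
    (hη : X.IsCoclosed (X.hodge ω)) (v : X.Vertex) :
    ∃ f : (X.universalCover v).DiscreteFunction, f.IsAnalytic ∧
      ∀ a : {l : List D // X.IsPath v l v},
        (∀ z, f.re (deckVertex (Pi1.mk a) z) - f.re z = pathSum ω a.1) ∧
        ∀ w, f.im (deckFace (Pi1.mk a) w) - f.im w = pathSum (X.primalMap (X.hodge ω)) a.1 := by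
  have hinv := hodge_inv hω.1
  obtain ⟨u, hu⟩ := exists_primitive hω v
  obtain ⟨w, hw⟩ := exists_dual_primitive (primalMap_mem hη hinv) (primalMap_apply (X.hodge ω)) v
  refine ⟨⟨u, w⟩, fun x => ?_, fun a => ⟨?_, ?_⟩⟩
  · obtain ⟨l, e, h, rfl⟩ := x.exists_mk
    have hp : X.proj v (CoverDart.mk l e h) = e := rfl
    simp only [right, head, universalCover_inv_mk, hu, hw, weight_universalCover, hp,
      pathSum_append, pathSum_cons, pathSum_nil, primalMap_apply]
    -- The jump of the imaginary part is c(e) - θ(e) - c(inv e) = c(next e) - c(inv e) = -η(inv e) =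
    -- η(e).
    have h1 := cornerMap_sub_cornerMap hη (X.inv e)
    rw [X.inv_inv, hinv, hodge_apply] at h1
    linarith
  · rintro ⟨x⟩
    obtain ⟨l, e, h, rfl⟩ := x.exists_mk
    change u ((X.universalCover v).tail (deck (Pi1.mk a) (CoverDart.mk l e h))) -
      u ((X.universalCover v).tail (CoverDart.mk l e h)) = _
    rw [deck_mk, hu, hu, pathSum_append, add_sub_cancel_right]
  · rintro ⟨x⟩
    obtain ⟨l, e, h, rfl⟩ := x.exists_mk
    change w ((X.universalCover v).left (deck (Pi1.mk a) (CoverDart.mk l e h))) -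
      w ((X.universalCover v).left (CoverDart.mk l e h)) = _
    rw [deck_mk, hw, hw, pathSum_append]
    ring

/-! ### Differentials of multi-valued functions, and uniqueness -/

theorem tail_mk_eq [Finite D] {v : X.Vertex} {l : List D} {e e' : D} (h : X.IsPath v l (X.tail e))
    (h' : X.IsPath v l (X.tail e')) :
    (X.universalCover v).tail (CoverDart.mk l e h) =
      (X.universalCover v).tail (CoverDart.mk l e' h') := by
  have hs : X.vertexPerm.SameCycle e e' := Quotient.exact (h.unique h')
  -- The same n rotations in the covering reach the other edge, since turning about a vertex keeps
  -- the homotopy class of the path.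
  obtain ⟨n, rfl⟩ := hs.exists_nat_pow_eq
  clear hs
  refine Quotient.sound ⟨n, ?_⟩
  obtain ⟨h1, h2⟩ := iterate_coverNext_coverInv v n l e h
  have h3 : (X.vertexPerm ^ n) e = (fun x => X.next (X.inv x))^[n] e := by
    rw [Equiv.Perm.coe_pow]; rfl
  have h4 : ((X.universalCover v).vertexPerm ^ n) (CoverDart.mk l e h) =
      (fun x => X.coverNext v (X.coverInv v x))^[n] (CoverDart.mk l e h) := by
    rw [Equiv.Perm.coe_pow]; rfl
  rw [zpow_natCast, h4]
  refine h2.trans (Quotient.sound ⟨Homotopic.refl _, h3.symm⟩)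

/-- Integration of the differential of a function on the vertices of the universal covering. -/
theorem sub_eq_pathSum [Finite D] {v : X.Vertex} {u : (X.universalCover v).Vertex → ℝ} {ω : D → ℝ}
    (hu : ∀ x, u ((X.universalCover v).head x) - u ((X.universalCover v).tail x) =
      ω (X.proj v x)) (l : List D) {m : List D} {e e' : D} (h : X.IsPath v m (X.tail e))
    (h' : X.IsPath v (m ++ l) (X.tail e')) :
    u ((X.universalCover v).tail (CoverDart.mk (m ++ l) e' h')) -
      u ((X.universalCover v).tail (CoverDart.mk m e h)) = pathSum ω l := by
  induction l generalizing m e with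
  | nil =>
    simp only [List.append_nil] at h' ⊢
    rw [tail_mk_eq h h', sub_self, pathSum_nil]
  | cons e₁ l ih =>
    have h1 : X.IsPath v m (X.tail e₁) := by
      obtain ⟨x, hx, hx', -⟩ := isPath_append.1 h'
      rwa [hx']
    have h2 := hu (CoverDart.mk m e₁ h1)
    rw [head, universalCover_inv_mk] at h2
    have h3 := ih (m := m ++ [e₁]) (e := X.inv e₁) (h1.append ⟨rfl, rfl⟩) (by simpa using h')
    simp only [List.append_assoc, List.singleton_append] at h3
    rw [tail_mk_eq h h1, pathSum_cons]
    change _ = ω e₁ at h2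
    linarith

theorem exists_tail_mk_nil (v : X.Vertex) : ∃ e, X.IsPath v [] (X.tail e) := by
  obtain ⟨e, rfl⟩ : ∃ e, X.tail e = v := Quotient.exists_rep v
  exact ⟨e, rfl⟩

theorem deckVertex_sub_eq_pathSum [Finite D] {v : X.Vertex} {u : (X.universalCover v).Vertex → ℝ}
    {ω : D → ℝ} (hu : ∀ x, u ((X.universalCover v).head x) - u ((X.universalCover v).tail x) =
      ω (X.proj v x)) (a : {l : List D // X.IsPath v l v}) {r : ℝ}
    (hr : ∀ z, u (deckVertex (Pi1.mk a) z) - u z = r) : pathSum ω a.1 = r := by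
  obtain ⟨e, he⟩ := exists_tail_mk_nil v
  have h1 := hr ((X.universalCover v).tail (CoverDart.mk [] e he))
  have h2 := sub_eq_pathSum hu a.1 he (e' := e) (by simpa using a.2.append he)
  change u ((X.universalCover v).tail (deck (Pi1.mk a) (CoverDart.mk [] e he))) - _ = _ at h1
  simp only [deck_mk, List.append_nil, List.nil_append] at h1 h2
  rw [← h1, h2]

theorem exists_eq_const [Finite D] {v : X.Vertex} {u : (X.universalCover v).Vertex → ℝ}
    (hu : ∀ x, u ((X.universalCover v).head x) - u ((X.universalCover v).tail x) = 0) :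
    ∃ a, ∀ z, u z = a := by
  obtain ⟨e₀, he₀⟩ := exists_tail_mk_nil v
  refine ⟨u ((X.universalCover v).tail (CoverDart.mk [] e₀ he₀)), ?_⟩
  rintro ⟨x⟩
  obtain ⟨l, e, h, rfl⟩ := x.exists_mk
  have := sub_eq_pathSum (ω := 0) hu l he₀ (e' := e) (by simpa using h)
  rw [← pathSumₗ_apply, map_zero] at this
  exact sub_eq_zero.1 this

theorem deck_mul {v : X.Vertex} (γ γ' : X.Pi1 v) (x : X.CoverDart v) :
    deck (γ * γ') x = deck γ (deck γ' x) := by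
  obtain ⟨l⟩ := γ
  obtain ⟨l'⟩ := γ'
  obtain ⟨p⟩ := x
  exact congrArg (Quotient.mk _) (Subtype.ext (Prod.ext (List.append_assoc _ _ _) rfl))

theorem deck_one {v : X.Vertex} (x : X.CoverDart v) : deck (1 : X.Pi1 v) x = x := by
  obtain ⟨p⟩ := x
  rfl

/-- A function on the universal covering that changes by constants under generators of the group of
deck transformations changes by constants under all deck transformations. -/
theorem exists_period {v : X.Vertex} {F : X.CoverDart v → ℝ} {S : Set (X.Pi1 v)}
    (hS : Subgroup.closure S = ⊤) (h : ∀ γ ∈ S, ∃ r, ∀ x, F (deck γ x) - F x = r)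
    (γ : X.Pi1 v) : ∃ r, ∀ x, F (deck γ x) - F x = r := by
  have hγ : γ ∈ Subgroup.closure S := hS ▸ Subgroup.mem_top γ
  induction hγ using Subgroup.closure_induction with
  | mem γ hγ => exact h γ hγ
  | one => exact ⟨0, fun x => by rw [deck_one, sub_self]⟩
  | mul γ γ' _ _ ih ih' =>
    obtain ⟨r, hr⟩ := ih
    obtain ⟨r', hr'⟩ := ih'
    exact ⟨r + r', fun x => by rw [deck_mul]; linarith [hr (deck γ' x), hr' x]⟩
  | inv γ _ ih =>
    obtain ⟨r, hr⟩ := ih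
    refine ⟨-r, fun x => ?_⟩
    have := hr (deck γ⁻¹ x)
    rw [← deck_mul, mul_inv_cancel, deck_one] at this
    linarith

/-- Deck transformations are transitive on fibres: follow the path of y, then that of x backwards.
-/
theorem exists_deck_eq {v : X.Vertex} {x y : X.CoverDart v} (h : X.proj v x = X.proj v y) :
    ∃ γ, deck γ x = y := by
  obtain ⟨l, e, hl, rfl⟩ := x.exists_mk
  obtain ⟨m, e', hm, rfl⟩ := y.exists_mk
  obtain rfl : e = e' := h
  refine ⟨Pi1.mk ⟨m ++ X.revPath l, hm.append hl.rev⟩, ?_⟩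
  rw [deck_mk]
  refine Quotient.sound ⟨?_, rfl⟩
  have := Homotopic.append_left hm (homotopic_rev_append hl)
  simpa using this

theorem IsConnected.exists_proj_eq (hX : X.IsConnected) (v : X.Vertex) (e : D) :
    ∃ x, X.proj v x = e := by
  obtain ⟨l, hl⟩ := hX.exists_isPath v (X.tail e)
  exact ⟨CoverDart.mk l e hl, rfl⟩

/-- A multi-valued function on the vertices has a single-valued differential. -/
theorem exists_differential (hX : X.IsConnected) {v : X.Vertex}
    {u : (X.universalCover v).Vertex → ℝ} {S : Set (X.Pi1 v)} (hS : Subgroup.closure S = ⊤)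
    (h : ∀ γ ∈ S, ∃ r, ∀ z, u (deckVertex γ z) - u z = r) :
    ∃ ω ∈ X.closedCochains, ∀ x,
      u ((X.universalCover v).head x) - u ((X.universalCover v).tail x) = ω (X.proj v x) := by
  have hper := exists_period (F := fun x => u ((X.universalCover v).tail x)) hS fun γ hγ => by
    obtain ⟨r, hr⟩ := h γ hγ
    exact ⟨r, fun x => hr ((X.universalCover v).tail x)⟩
  choose s hs using hX.exists_proj_eq v
  set ω : D → ℝ := fun e => u ((X.universalCover v).head (s e)) - u ((X.universalCover v).tail (s e))
  have hω : ∀ x, u ((X.universalCover v).head x) - u ((X.universalCover v).tail x) =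
      ω (X.proj v x) := by
    -- Any lift of an edge is a deck translate of the chosen one, and a deck transformation changes
    -- u by the same constant at both ends.
    intro x
    obtain ⟨γ, hγ⟩ := exists_deck_eq (hs (X.proj v x))
    obtain ⟨r, hr⟩ := hper γ
    have h1 := hr (s (X.proj v x))
    have h2 := hr ((X.universalCover v).inv (s (X.proj v x)))
    rw [deck_inv] at h2
    rw [hγ] at h1 h2
    simp only [head, ω]
    linarith
  have hinv : ∀ x, X.proj v ((X.universalCover v).inv x) = X.inv (X.proj v x) :=
    proj_coverInv v
  have hnext : ∀ x, X.proj v ((X.universalCover v).next x) = X.next (X.proj v x) :=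
    proj_coverNext v
  refine ⟨ω, ⟨fun e => ?_, fun e => ?_⟩, hω⟩
  · obtain ⟨x, rfl⟩ := hX.exists_proj_eq v e
    rw [← hinv, ← hω, ← hω, head_inv, head]
    ring
  · obtain ⟨x, rfl⟩ := hX.exists_proj_eq v e
    rw [← hnext, ← hnext, ← hω, ← hω, ← hω, tail_next, tail_next, head_next_next]
    ring

/-- The lift of a closed path around a vertex is closed, so that the dual differential of a function
on the faces of the universal covering is coclosed. -/
theorem isCoclosed_of_dual_differential (hX : X.IsConnected) [Finite D] {v : X.Vertex}
    {w : (X.universalCover v).Face → ℝ} {η : D → ℝ}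
    (h : ∀ x, w ((X.universalCover v).left x) - w ((X.universalCover v).right x) =
      η (X.proj v x)) : X.IsCoclosed η := by
  intro e
  obtain ⟨l, hl⟩ := hX.exists_isPath v (X.tail e)
  set y : ℕ → X.CoverDart v := fun n =>
    (fun x => X.coverNext v (X.coverInv v x))^[n] (CoverDart.mk l e hl) with hy
  have hyn : ∀ n, ∃ h', y n = CoverDart.mk l ((X.vertexPerm ^ n) e) h' := by
    intro n
    rw [Equiv.Perm.coe_pow]
    exact iterate_coverNext_coverInv v n l e hl
  -- Consecutive edges around a vertex share a face, so the sum of η telescopes; it closes up after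
  -- a full number of turns.
  have hstep : ∀ n, (X.universalCover v).left (y (n + 1)) = (X.universalCover v).right (y n) := by
    intro n
    simp only [hy, Function.iterate_succ_apply']
    refine Quotient.sound (Equiv.Perm.SameCycle.symm ⟨1, ?_⟩)
    rfl
  have hη : ∀ n, η ((X.vertexPerm ^ n) e) =
      w ((X.universalCover v).left (y n)) - w ((X.universalCover v).left (y (n + 1))) := by
    intro n
    obtain ⟨h', hn⟩ := hyn n
    rw [hstep, h, hn]
    rfl
  simp only [hη]
  rw [Finset.sum_range_sub', sub_eq_zero]
  obtain ⟨h', hn⟩ := hyn (orderOf X.vertexPerm)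
  simp only [hn, pow_orderOf_eq_one]
  rfl

/-- A function on the faces of the universal covering gives a function on the vertices with the same
periods. -/
theorem exists_vertex_function_of_dual [Finite D] {v : X.Vertex}
    {w : (X.universalCover v).Face → ℝ} {η : D → ℝ} (hη : X.IsCoclosed η)
    (h : ∀ x, w ((X.universalCover v).left x) - w ((X.universalCover v).right x) =
      η (X.proj v x)) :
    ∃ u : (X.universalCover v).Vertex → ℝ,
      (∀ x, u ((X.universalCover v).tail x) =
        w ((X.universalCover v).left x) - X.cornerMap η (X.proj v x)) ∧
      ∀ x, u ((X.universalCover v).head x) - u ((X.universalCover v).tail x) =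
        X.primalMap η (X.proj v x) := by
  have hinv : ∀ x, X.proj v ((X.universalCover v).inv x) = X.inv (X.proj v x) :=
    proj_coverInv v
  have hnext : ∀ x, X.proj v ((X.universalCover v).next x) = X.next (X.proj v x) :=
    proj_coverNext v
  have hleft : ∀ x, (X.universalCover v).left ((X.universalCover v).next x) =
      (X.universalCover v).left x := fun x =>
    Quotient.sound (Equiv.Perm.SameCycle.symm ⟨1, rfl⟩)
  -- Under rotation about a vertex both w(left) and the corner value drop by η, so their difference
  -- depends only on the vertex.
  obtain ⟨u, hu⟩ := exists_vertex_function (X := X.universalCover v)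
    (f := fun x => w ((X.universalCover v).left x) - X.cornerMap η (X.proj v x)) (by
      intro x
      have h1 := cornerMap_sub_cornerMap hη (X.proj v x)
      have h2 := h x
      rw [hleft, hnext, hinv]
      change _ - w ((X.universalCover v).left ((X.universalCover v).inv x)) = _ at h2
      linarith)
  refine ⟨u, hu, fun x => ?_⟩
  rw [← tail_next, hu, hu, hleft, hnext, primalMap_apply]
  ring

theorem IsAbelianIntegral.sub {v : X.Vertex} {g : ℕ} {α β : Fin g → X.Pi1 v}
    {f f' : (X.universalCover v).DiscreteFunction} {A A' : Fin g → ℂ}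
    (h : IsAbelianIntegral α β f A) (h' : IsAbelianIntegral α β f' A') :
    IsAbelianIntegral α β ⟨f.re - f'.re, f.im - f'.im⟩ (A - A') := by
  obtain ⟨⟨B, hB⟩, hf⟩ := h
  obtain ⟨⟨B', hB'⟩, hf'⟩ := h'
  refine ⟨⟨B - B', fun k => ?_⟩, fun e => ?_⟩
  · obtain ⟨h1, h2, h3, h4⟩ := hB k
    obtain ⟨h1', h2', h3', h4'⟩ := hB' k
    refine ⟨fun z => ?_, fun z => ?_, fun w => ?_, fun w => ?_⟩ <;>
      simp only [Pi.sub_apply, Complex.sub_re, Complex.sub_im]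
    · rw [← h1 z, ← h1' z]; ring
    · rw [← h2 z, ← h2' z]; ring
    · rw [← h3 w, ← h3' w]; ring
    · rw [← h4 w, ← h4' w]; ring
  · have h1 := hf e
    have h2 := hf' e
    simp only [Pi.sub_apply]
    linear_combination h1 - h2

theorem IsStandardBasis.const_of_isAbelianIntegral [Finite D] (hX : X.IsConnected) {g : ℕ}
    (hg : 1 ≤ g) (hgenus : X.HasGenus g) {v : X.Vertex}
    {a b : Fin g → {l : List D // X.IsPath v l v}}
    (hbasis : IsStandardBasis (fun k => Pi1.mk (a k)) fun k => Pi1.mk (b k))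
    {f : (X.universalCover v).DiscreteFunction}
    (hf : IsAbelianIntegral (fun k => Pi1.mk (a k)) (fun k => Pi1.mk (b k)) f 0) :
    ∃ p q : ℝ, (∀ z, f.re z = p) ∧ ∀ w, f.im w = q := by
  obtain ⟨⟨B, hB⟩, hf⟩ := hf
  obtain ⟨ω, hω, hre⟩ := exists_differential hX (u := f.re) hbasis.1 (by
    rintro _ (⟨k, rfl⟩ | ⟨k, rfl⟩)
    exacts [⟨_, (hB k).1⟩, ⟨_, (hB k).2.1⟩])
  have him : ∀ x, f.im ((X.universalCover v).left x) - f.im ((X.universalCover v).right x) =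
      X.hodge ω (X.proj v x) := by
    intro x
    rw [hf x, hre, weight_universalCover, hodge_apply]
  have hη := isCoclosed_of_dual_differential hX him
  obtain ⟨u, hu, hu'⟩ := exists_vertex_function_of_dual hη him
  have hω0 : ω = 0 := by
    refine hbasis.eq_zero_of_harmonic hX hg hgenus hω hη
      (fun k => deckVertex_sub_eq_pathSum hre (a k) (hB k).1)
      fun k => deckVertex_sub_eq_pathSum hu' (a k) ?_
    -- The corner correction is pulled back from the surface, hence deck-invariant, and u inherits
    -- the zero A-periods of Im f.
    rintro ⟨x⟩
    have h1 := hu x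
    have h2 := hu (deck (Pi1.mk (a k)) x)
    rw [proj_deck] at h2
    have h3 := (hB k).2.2.1 ((X.universalCover v).left x)
    change f.im ((X.universalCover v).left (deck (Pi1.mk (a k)) x)) - _ = 0 at h3
    change u ((X.universalCover v).tail (deck (Pi1.mk (a k)) x)) -
      u ((X.universalCover v).tail x) = 0
    linarith
  subst hω0
  obtain ⟨p, hp⟩ := exists_eq_const hre
  obtain ⟨q, hq⟩ := exists_eq_const (u := u) fun x => by simp [hu']
  -- With ω = 0 the corner correction vanishes, so Im f takes the constant value of u.
  refine ⟨p, q, hp, ?_⟩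
  rintro ⟨x⟩
  have := hu x
  rw [hq, map_zero, map_zero] at this
  change f.im ((X.universalCover v).left x) = q
  simpa using this.symm

end PolyhedralSurface

theorem mainTheorem6 {D : Type*} [Finite D] (X : PolyhedralSurface D) (hX : X.IsConnected)
    {g : ℕ} (hg : 1 ≤ g) (hgenus : X.HasGenus g) (v : X.Vertex) (α β : Fin g → X.Pi1 v)
    (hbasis : PolyhedralSurface.IsStandardBasis α β) (A : Fin g → ℂ) :
    (∃ f : (X.universalCover v).DiscreteFunction,
      PolyhedralSurface.IsAbelianIntegral α β f A) ∧
    ∀ f f' : (X.universalCover v).DiscreteFunction,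
      PolyhedralSurface.IsAbelianIntegral α β f A →
      PolyhedralSurface.IsAbelianIntegral α β f' A →
      ∃ a b : ℝ, (∀ z, f'.re z = f.re z + a) ∧ ∀ w, f'.im w = f.im w + b := by
  have hrep : ∀ γ : X.Pi1 v, ∃ l, PolyhedralSurface.Pi1.mk l = γ := Quotient.exists_rep
  choose a ha using fun k => hrep (α k)
  choose b hb using fun k => hrep (β k)
  obtain rfl : (fun k => PolyhedralSurface.Pi1.mk (a k)) = α := funext ha
  obtain rfl : (fun k => PolyhedralSurface.Pi1.mk (b k)) = β := funext hb
  constructor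
  · obtain ⟨ω, hω, hη, h1, h2⟩ := hbasis.exists_harmonic hX hg hgenus
      (fun k => (A k).re) fun k => (A k).im
    obtain ⟨f, hf, hper⟩ := PolyhedralSurface.exists_analytic hω hη v
    -- The B-periods are not prescribed: they are the sums of ω and of its conjugate along the loops
    -- representing β.
    refine ⟨f, ⟨fun k => ⟨PolyhedralSurface.pathSum ω (b k).1,
      PolyhedralSurface.pathSum (X.primalMap (X.hodge ω)) (b k).1⟩, fun k => ?_⟩, hf⟩
    rw [← h1 k, ← h2 k]
    exact ⟨(hper (a k)).1, (hper (b k)).1, (hper (a k)).2, (hper (b k)).2⟩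
  · intro f f' hf hf'
    have hsub := hf'.sub hf
    rw [sub_self] at hsub
    obtain ⟨p, q, hp, hq⟩ := hbasis.const_of_isAbelianIntegral hX hg hgenus hsub
    refine ⟨p, q, fun z => ?_, fun w => ?_⟩
    · rw [← hp z]; simp
    · rw [← hq w]; simp
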